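/- Let $K$ be a field of characteristic $0$. Let $K((\mathbb{R}))$ be the Hahn field of generalised power series $b=\sum_{x\in\mathbb{R}}k_xt^x$ with $k_x\in K$ and well-ordered support $\operatorname{supp}(b)=\{x\in\mathbb{R}: k_x\neq 0\}$, and let $K((\mathbb{R}^{\leq 0}))$ be the subring of the series whose support is contained in $\mathbb{R}^{\leq 0}=\{x\in\mathbb{R}: x\leq 0\}$. For an ordinal $\alpha$ let $\deg(\alpha)$ be the maximum $\beta\in\mathbf{On}\cup\{-\infty\}$ such that $\omega^\beta\leq\alpha$, where $\omega^{-\infty}:=0$ and $-\infty<\beta$ for every ordinal $\beta$ (so for $\alpha\neq0$ it is the leading exponent of the Cantor normal form of $\alpha$, and $\deg(0)=-\infty$). For a series $b$ let $\deg(b):=\deg(\mathrm{ot}(b))$, where $\mathrm{ot}(b)$ is the order type of $\operatorname{supp}(b)$. Let $\oplus$ be Hessenberg's natural sum of ordinals, obtained by collecting all the terms of the two Cantor normal forms in decreasing order, and extended by $\alpha\oplus(-\infty)=(-\infty)\oplus\alpha=-\infty$. Then $\deg$ is an ordinal-valued valuation on $K((\mathbb{R}^{\leq 0}))$ (up to reversing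 the order of the ordinals), that is, for all $b,c\in K((\mathbb{R}^{\leq 0}))$: \begin{itemize} \item $\deg(b)=-\infty$ if and only if $b=0$; \item $\deg(b+c)\leq\max\{\deg(b),\deg(c)\}$; \item $\deg(b\cdot c)=\deg(b)\oplus\deg(c)$. \end{itemize} -/

import Mathlib

noncomputable section

open Ordinal

universe u v

namespace GenSeries

/-- Hessenberg's natural sum of two ordinals: add the Cantor normal forms of `a` and `b`
coefficientwise (that is, collect all the terms `ω ^ γ` of both normal forms) and evaluate the
result as a Cantor normal form, exponents in decreasing order. -/
def naturalSum (a b : Ordinal.{u}) : Ordinal.{u} :=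
  CNF.eval ω (CNF.coeff ω a + CNF.coeff ω b)

/-- The natural sum on `On ∪ {-∞}` (here `WithBot Ordinal`, with `⊥ = -∞`), where the sum
is `-∞` as soon as one of the two arguments is `-∞`. -/
def naturalSumBot (a b : WithBot Ordinal.{u}) : WithBot Ordinal.{u} :=
  WithBot.map₂ naturalSum a b

/-- The function `α ↦ ω ^ α` on `On ∪ {-∞}`, with the convention `ω ^ (-∞) = 0`. -/
def omegaPow (a : WithBot Ordinal.{u}) : Ordinal.{u} :=
  a.recBotCoe 0 (fun o => ω ^ o)

open Classical in
/-- The degree of an ordinal `a`: the maximum `β` in `On ∪ {-∞}` with `ω ^ β ≤ a`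
(this is proved in `isGreatest_ordinalDegree`). -/
def ordinalDegree (a : Ordinal.{u}) : WithBot Ordinal.{u} :=
  if a = 0 then ⊥ else ((Ordinal.log ω a : Ordinal.{u}) : WithBot Ordinal.{u})

theorem isGreatest_ordinalDegree (a : Ordinal.{u}) :
    IsGreatest {β : WithBot Ordinal.{u} | omegaPow β ≤ a} (ordinalDegree a) := by
  unfold ordinalDegree
  split_ifs with h
  · subst h
    refine ⟨by simp [omegaPow], fun β hβ => ?_⟩
    induction β using WithBot.recBotCoe with
    | bot => exact le_rfl
    | coe o =>
      exact absurd (le_antisymm hβ zero_le) (Ordinal.opow_ne_zero o Ordinal.omega0_ne_zero)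
  · refine ⟨Ordinal.opow_log_le_self _ h, fun β hβ => ?_⟩
    induction β using WithBot.recBotCoe with
    | bot => exact bot_le
    | coe o =>
      exact WithBot.coe_le_coe.2 (Ordinal.le_log_of_opow_le Ordinal.one_lt_omega0 hβ)

section Series

variable {Γ : Type u} [LinearOrder Γ] {K : Type v} [Zero K]

instance support_wellFoundedLT (b : HahnSeries Γ K) : WellFoundedLT b.support :=
  ⟨b.isWF_support⟩

/-- The order type of a generalised power series: the order type of its support. -/
def orderType (b : HahnSeries Γ K) : Ordinal.{u} :=
  Ordinal.type (fun x y : b.support => x < y)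

/-- The degree of a generalised power series: the degree of its order type. -/
def degree (b : HahnSeries Γ K) : WithBot Ordinal.{u} :=
  ordinalDegree (orderType b)

end Series

/-- The ring `K((ℝ^{≤0}))`, as the subring of the Hahn field `K((ℝ))` that consists of the
series all of whose exponents are `≤ 0`. -/
def nonposSeries (K : Type v) [Field K] : Subring (HahnSeries ℝ K) where
  carrier := {b | b.support ⊆ Set.Iic 0}
  zero_mem' := by simp
  one_mem' := by simp
  add_mem' := fun {a b} ha hb => (HahnSeries.support_add_subset a b).trans (Set.union_subset ha hb)
  neg_mem' := fun {a} ha => by simpa using ha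
  mul_mem' := fun {a b} ha hb x hx => by
    obtain ⟨y, hy, z, hz, rfl⟩ := HahnSeries.support_mul_subset hx
    exact Set.mem_Iic.2 (add_nonpos (Set.mem_Iic.1 (ha hy)) (Set.mem_Iic.1 (hb hz)))

end GenSeries

end

noncomputable section

open Ordinal

universe u v

namespace GenSeries

-- The proof localises the degree. `localDegree f x` is the degree of `f` on short intervals `(y,
-- x]`. It is at most `b` exactly when all points just left of `x` have local degree below `b`
-- (`localDegree_le_coe_iff`), so local degrees are accessible to induction on ordinals; and the
-- degree of a series with support bounded above is the maximum of its local degrees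
-- (`exists_localDegree_eq_degree`). This gives the inequality for sums. For products, a compactness
-- argument bounds the local degree at `x` by the natural sum of the local degrees at some pair of
-- points with sum `x` (`exists_localDegree_mul_le`).
--
-- The obstacle to the reverse inequality is cancellation. Over an ordered field it is excluded by a
-- notion of sign at a point. If `f` has local degree `b ≠ 0` at `x`, write `b = c ♯ ω ^ a` with `ω
-- ^ a` the last term of its normal form. The sign of `f` at `x` is the sign, defined recursively,
-- at the first point of an interval `(x + z, x)` where the local degree reaches `c ♯ r`, as `z`
-- tends to `0` and `r` to `ω ^ a` along an ultrafilter. Positive series do not cancel in sums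
-- (`Pos.localDegree_add_and_add`). For `f`, `g` supported up to `x`, `y`, the product near `x + y`
-- is, up to a small error, a truncation of `f` times `g` plus `f` times a truncation of `g`.
-- Induction on `b ♯ c` then shows that positive times positive is positive, with local degree
-- exactly `b ♯ c` (`Pos.localDegree_mul_and_mul`).
--
-- Over `ℂ`, multiplying a series by its conjugate gives a sum of two real squares, which do not
-- cancel. In characteristic `0`, the countably many coefficients of two series lie in a countable
-- subfield, which embeds in `ℂ`; this gives `localDegree_mul`. Finally, `degree_mul` applies this
-- at the sum of the first points where the two factors attain their degrees.

local infixl:65 " ♯ " => naturalSum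
local infixl:65 " ♯ᵇ " => naturalSumBot

/-! ### Natural sums -/

/-- The coefficient of `ω ^ e` in the Cantor normal form of `a`, as a natural number. -/
def cnfCoeff (a e : Ordinal.{u}) : ℕ :=
  Cardinal.toNat (CNF.coeff ω a e).card

theorem coeff_lt_omega0 (a e : Ordinal.{u}) : CNF.coeff ω a e < ω := by
  by_cases h : e ∈ (CNF ω a).map Prod.fst
  · obtain ⟨⟨e', c⟩, hc, rfl⟩ := List.mem_map.1 h
    rw [CNF.coeff_of_mem_CNF hc]
    exact CNF.snd_lt one_lt_omega0 hc
  · rw [CNF.coeff_of_notMem_CNF h]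
    exact omega0_pos

theorem natCast_cnfCoeff (a e : Ordinal.{u}) : (cnfCoeff a e : Ordinal) = CNF.coeff ω a e := by
  obtain ⟨n, hn⟩ := lt_omega0.1 (coeff_lt_omega0 a e)
  simp [cnfCoeff, hn]

theorem coeff_naturalSum (a b : Ordinal.{u}) :
    CNF.coeff ω (a ♯ b) = CNF.coeff ω a + CNF.coeff ω b :=
  CNF.coeff_eval one_lt_omega0 fun e =>
    isPrincipal_add_omega0 (coeff_lt_omega0 a e) (coeff_lt_omega0 b e)

theorem cnfCoeff_naturalSum (a b e : Ordinal.{u}) :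
    cnfCoeff (a ♯ b) e = cnfCoeff a e + cnfCoeff b e := by
  have : ((cnfCoeff (a ♯ b) e : ℕ) : Ordinal.{u}) = (cnfCoeff a e + cnfCoeff b e : ℕ) := by
    rw [natCast_cnfCoeff, coeff_naturalSum, Nat.cast_add, natCast_cnfCoeff, natCast_cnfCoeff,
      Finsupp.add_apply]
  exact_mod_cast this

theorem cnfCoeff_ext {a b : Ordinal.{u}} (h : ∀ e, cnfCoeff a e = cnfCoeff b e) : a = b :=
  CNF.coeff_injective ω <| Finsupp.ext fun e => by
    rw [← natCast_cnfCoeff, ← natCast_cnfCoeff, h]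

theorem finite_cnfCoeff_ne_zero (a : Ordinal.{u}) : {e | cnfCoeff a e ≠ 0}.Finite := by
  refine (CNF.coeff ω a).hasFiniteSupport.subset fun e he => ?_
  rw [Function.mem_support, ← natCast_cnfCoeff]
  exact_mod_cast he

theorem exists_cnfCoeff_eq (f : Ordinal.{u} → ℕ) (hf : {e | f e ≠ 0}.Finite) :
    ∃ a : Ordinal.{u}, ∀ e, cnfCoeff a e = f e := by
  let g : Ordinal.{u} →₀ Ordinal.{u} :=
    Finsupp.ofSupportFinite (fun e => (f e : Ordinal.{u})) (hf.subset fun e he => by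
      simpa using he)
  refine ⟨CNF.eval ω g, fun e => ?_⟩
  have h : CNF.coeff ω (CNF.eval ω g) = g :=
    CNF.coeff_eval one_lt_omega0 fun e => natCast_lt_omega0 (f e)
  have : ((cnfCoeff (CNF.eval ω g) e : ℕ) : Ordinal.{u}) = (f e : ℕ) := by
    rw [natCast_cnfCoeff, h]
    rfl
  exact_mod_cast this

/-- Cut both normal forms at `e`. The parts above `e` agree, and the part of `a` below `e` is less
than `ω ^ e`, so it cannot make up for one missing copy of `ω ^ e`. -/
theorem lt_of_cnfCoeff_lt {a b e : Ordinal.{u}} (he : cnfCoeff a e < cnfCoeff b e)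
    (h : ∀ e', e < e' → cnfCoeff a e' = cnfCoeff b e') : a < b := by
  have split (c : Ordinal.{u}) : c = CNF.eval ω ((CNF.coeff ω c).filter (e < ·)) +
      (ω ^ e * CNF.coeff ω c e + CNF.eval ω ((CNF.coeff ω c).filter (· < e))) := by
    rw [← CNF.eval_single_add', ← CNF.eval_add]
    · conv_lhs => rw [← CNF.eval_coeff ω c]
      congr 1
      ext x
      rcases lt_trichotomy x e with hx | rfl | hx
      · simp [hx, hx.not_gt, hx.ne]
      · simp
      · simp [hx, hx.not_gt, hx.ne']
    · intro e₁ h₁ e₂ h₂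
      have h₁' : e < e₁ := by
        by_contra hc
        simp [hc] at h₁
      refine le_trans ?_ h₁'.le
      by_contra hc
      have := not_le.1 hc
      simp [this.not_gt, this.ne'] at h₂
    · intro e' he'
      by_contra hc
      simp [hc] at he'
  rw [split a, split b]
  have hab : (CNF.coeff ω a).filter (e < ·) = (CNF.coeff ω b).filter (e < ·) := by
    ext x
    by_cases hx : e < x
    · simp only [Finsupp.filter_apply, hx, if_true, ← natCast_cnfCoeff, h x hx]
    · simp only [Finsupp.filter_apply, hx, if_false]
  rw [hab]
  refine (add_lt_add_iff_left _).2 (lt_of_lt_of_le ?_ le_self_add)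
  have h1 : CNF.eval ω ((CNF.coeff ω a).filter (· < e)) < ω ^ e := by
    refine CNF.eval_lt (fun e' => ?_) fun e' he' => ?_
    · rw [Finsupp.filter_apply]
      split_ifs
      exacts [coeff_lt_omega0 _ _, omega0_pos]
    · by_contra hc
      simp [hc] at he'
  calc _ < ω ^ e * CNF.coeff ω a e + ω ^ e := (add_lt_add_iff_left _).2 h1
    _ = ω ^ e * Order.succ (CNF.coeff ω a e) := by rw [Ordinal.mul_succ]
    _ ≤ _ := by
      gcongr
      rw [Order.succ_le_iff, ← natCast_cnfCoeff, ← natCast_cnfCoeff]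
      exact_mod_cast he

/-- Only finitely many coefficients differ, and the largest exponent at which they do decides. Since
natural sums add coefficients, their monotonicity and cancellation properties follow from this. -/
theorem lt_iff_cnfCoeff {a b : Ordinal.{u}} : a < b ↔
    ∃ e, cnfCoeff a e < cnfCoeff b e ∧ ∀ e', e < e' → cnfCoeff a e' = cnfCoeff b e' := by
  refine ⟨fun hab => ?_, fun ⟨e, he, h⟩ => lt_of_cnfCoeff_lt he h⟩
  have hfin : {e | cnfCoeff a e ≠ cnfCoeff b e}.Finite := by
    refine ((finite_cnfCoeff_ne_zero a).union (finite_cnfCoeff_ne_zero b)).subset fun e he => ?_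
    by_contra hc
    simp only [Set.mem_union, Set.mem_ofPred_eq, not_or, not_not] at hc he
    exact he (hc.1.trans hc.2.symm)
  have hne : {e | cnfCoeff a e ≠ cnfCoeff b e}.Nonempty := by
    by_contra hc
    refine hab.ne (cnfCoeff_ext fun e => ?_)
    by_contra he
    exact hc ⟨e, he⟩
  obtain ⟨e, he, hmax⟩ := hfin.exists_maximal hne
  have habove : ∀ e', e < e' → cnfCoeff a e' = cnfCoeff b e' := fun e' he' => by
    by_contra hc
    exact he'.not_ge (hmax hc he'.le)
  rcases lt_or_gt_of_ne he with h | h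
  · exact ⟨e, h, habove⟩
  · exact absurd (lt_of_cnfCoeff_lt h fun e' he' => (habove e' he').symm) hab.not_gt

theorem naturalSum_comm (a b : Ordinal.{u}) : a ♯ b = b ♯ a :=
  cnfCoeff_ext fun e => by simp only [cnfCoeff_naturalSum, add_comm]

theorem naturalSum_assoc (a b c : Ordinal.{u}) : a ♯ b ♯ c = a ♯ (b ♯ c) :=
  cnfCoeff_ext fun e => by simp only [cnfCoeff_naturalSum, add_assoc]

instance : Std.Commutative (naturalSum : Ordinal.{u} → Ordinal.{u} → Ordinal.{u}) :=
  ⟨naturalSum_comm⟩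

instance : Std.Associative (naturalSum : Ordinal.{u} → Ordinal.{u} → Ordinal.{u}) :=
  ⟨naturalSum_assoc⟩

theorem cnfCoeff_zero (e : Ordinal.{u}) : cnfCoeff 0 e = 0 := by
  simp [cnfCoeff]

theorem naturalSum_zero (a : Ordinal.{u}) : a ♯ 0 = a :=
  cnfCoeff_ext fun e => by simp only [cnfCoeff_naturalSum, cnfCoeff_zero, add_zero]

theorem naturalSum_lt_naturalSum_left {a b : Ordinal.{u}} (c : Ordinal.{u}) (h : a < b) :
    a ♯ c < b ♯ c := by
  obtain ⟨e, he, h⟩ := lt_iff_cnfCoeff.1 h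
  refine lt_iff_cnfCoeff.2 ⟨e, ?_, fun e' he' => ?_⟩
  · simpa only [cnfCoeff_naturalSum, add_lt_add_iff_right] using he
  · simp only [cnfCoeff_naturalSum, h e' he']

theorem naturalSum_lt_naturalSum_right {a b : Ordinal.{u}} (c : Ordinal.{u}) (h : a < b) :
    c ♯ a < c ♯ b := by
  rw [naturalSum_comm c, naturalSum_comm c]
  exact naturalSum_lt_naturalSum_left c h

theorem naturalSum_le_naturalSum {a b c d : Ordinal.{u}} (h : a ≤ b) (h' : c ≤ d) :
    a ♯ c ≤ b ♯ d := by
  calc a ♯ c ≤ b ♯ c := by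
        rcases h.eq_or_lt with rfl | h
        exacts [le_rfl, (naturalSum_lt_naturalSum_left c h).le]
    _ ≤ b ♯ d := by
        rcases h'.eq_or_lt with rfl | h'
        exacts [le_rfl, (naturalSum_lt_naturalSum_right b h').le]

theorem lt_omega0_opow_iff {r a : Ordinal.{u}} :
    r < ω ^ a ↔ ∀ e, a ≤ e → cnfCoeff r e = 0 := by
  constructor
  · intro h e he
    have : ((cnfCoeff r e : ℕ) : Ordinal.{u}) = 0 := by
      rw [natCast_cnfCoeff]
      exact CNF.coeff_eq_zero_of_lt (h.trans_le (opow_le_opow_right omega0_pos he))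
    exact_mod_cast this
  · intro h
    rw [← CNF.eval_coeff ω r]
    refine CNF.eval_lt (coeff_lt_omega0 r) fun e he => ?_
    by_contra hc
    rw [Finsupp.mem_support_iff, ← natCast_cnfCoeff, h e (not_lt.1 hc)] at he
    simp at he

theorem naturalSum_lt_omega0_opow {r s a : Ordinal.{u}} (hr : r < ω ^ a) (hs : s < ω ^ a) :
    r ♯ s < ω ^ a := by
  rw [lt_omega0_opow_iff] at *
  intro e he
  rw [cnfCoeff_naturalSum, hr e he, hs e he]

theorem cnfCoeff_omega0_opow (a e : Ordinal.{u}) :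
    cnfCoeff (ω ^ a) e = if e = a then 1 else 0 := by
  obtain ⟨b, hb⟩ := exists_cnfCoeff_eq (fun e : Ordinal.{u} => if e = a then 1 else 0)
    ((Set.finite_singleton a).subset fun e he => by simpa using he)
  rw [← hb]
  congr 1
  have h := CNF.coeff_opow_mul_add (b := ω) (e := a) (x := 1) (y := 0) one_lt_omega0 one_ne_zero
    one_lt_omega0 (opow_pos _ omega0_pos)
  rw [mul_one, add_zero] at h
  refine cnfCoeff_ext fun e => ?_
  rw [hb]
  have h2 := natCast_cnfCoeff (ω ^ a) e
  rw [h] at h2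
  split_ifs with hc
  · subst hc
    simp at h2
    exact_mod_cast h2
  · simp [Ne.symm hc] at h2
    exact_mod_cast h2

/-! ### Last terms of Cantor normal forms -/

/-- `ω ^ a` is the last term of the Cantor normal form of `b`, and `c` is what remains when this
term is removed. -/
def IsTail (b c a : Ordinal.{u}) : Prop :=
  b = c ♯ ω ^ a ∧ ∀ e, e < a → cnfCoeff c e = 0

theorem exists_isTail {b : Ordinal.{u}} (hb : b ≠ 0) : ∃ c a, IsTail b c a := by
  have hne : {e | cnfCoeff b e ≠ 0}.Nonempty := by
    by_contra hc
    refine hb (cnfCoeff_ext fun e => ?_)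
    by_contra he
    exact hc ⟨e, fun h => he (h.trans (cnfCoeff_zero e).symm)⟩
  obtain ⟨a, ha, hmin⟩ := (finite_cnfCoeff_ne_zero b).exists_minimal hne
  obtain ⟨c, hc⟩ := exists_cnfCoeff_eq (fun e => if e = a then cnfCoeff b a - 1 else cnfCoeff b e)
    ((finite_cnfCoeff_ne_zero b).subset fun e he => by
      by_cases h : e = a
      · exact h ▸ ha
      · simpa [h] using he)
  refine ⟨c, a, cnfCoeff_ext fun e => ?_, fun e he => ?_⟩
  · rw [cnfCoeff_naturalSum, hc, cnfCoeff_omega0_opow]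
    split_ifs with h
    · subst h
      have : cnfCoeff b e ≠ 0 := ha
      omega
    · rfl
  · rw [hc, if_neg he.ne]
    by_contra h
    exact he.not_ge (hmin h he.le)

/-- What remains of the Cantor normal form when its last term is removed. -/
def base (b : Ordinal.{u}) : Ordinal.{u} :=
  open Classical in if h : b ≠ 0 then (exists_isTail h).choose else 0

/-- The last exponent of the Cantor normal form. -/
def lastExp (b : Ordinal.{u}) : Ordinal.{u} :=
  open Classical in if h : b ≠ 0 then (exists_isTail h).choose_spec.choose else 0

theorem isTail_base {b : Ordinal.{u}} (hb : b ≠ 0) : IsTail b (base b) (lastExp b) := by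
  rw [base, lastExp, dif_pos hb, dif_pos hb]
  exact (exists_isTail hb).choose_spec.choose_spec

theorem IsTail.ne_zero {b c a : Ordinal.{u}} (h : IsTail b c a) : b ≠ 0 := by
  rintro rfl
  have := cnfCoeff_zero a
  rw [h.1, cnfCoeff_naturalSum, cnfCoeff_omega0_opow, if_pos rfl] at this
  omega

theorem IsTail.cnfCoeff_eq_zero {b c a : Ordinal.{u}} (h : IsTail b c a) {e : Ordinal.{u}}
    (he : e < a) : cnfCoeff b e = 0 := by
  rw [h.1, cnfCoeff_naturalSum, cnfCoeff_omega0_opow, if_neg he.ne, h.2 e he]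

theorem IsTail.cnfCoeff_ne_zero {b c a : Ordinal.{u}} (h : IsTail b c a) : cnfCoeff b a ≠ 0 := by
  rw [h.1, cnfCoeff_naturalSum, cnfCoeff_omega0_opow, if_pos rfl]
  omega

theorem IsTail.unique {b c a : Ordinal.{u}} (h : IsTail b c a) :
    base b = c ∧ lastExp b = a := by
  have h' := isTail_base h.ne_zero
  have ha : lastExp b = a := by
    rcases lt_trichotomy (lastExp b) a with hlt | heq | hlt
    · exact absurd (h.cnfCoeff_eq_zero hlt) h'.cnfCoeff_ne_zero
    · exact heq
    · exact absurd (h'.cnfCoeff_eq_zero hlt) h.cnfCoeff_ne_zero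
  refine ⟨cnfCoeff_ext fun e => ?_, ha⟩
  have h1 := congrArg (cnfCoeff · e) (h'.1.symm.trans h.1)
  simp only [cnfCoeff_naturalSum, ha] at h1
  omega

/-- Together with `base_naturalSum_lt`, this says that the thresholds `base b ♯ r` are cofinal in
`b`. At the highest exponent where `t` and `b` differ, either `t` is already below `base b`, or that
exponent is the last one of `b` and the lower terms of `t` serve as `r`. -/
theorem exists_le_base_naturalSum {b t : Ordinal.{u}} (ht : t < b) :
    ∃ r < ω ^ lastExp b, t ≤ base b ♯ r := by
  have hb := isTail_base (ne_bot_of_gt ht : b ≠ 0)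
  generalize lastExp b = a at *
  generalize base b = c at *
  have hpos : (0 : Ordinal.{u}) < ω ^ a := opow_pos _ omega0_pos
  obtain ⟨e, he, habove⟩ := lt_iff_cnfCoeff.1 ht
  have hae : a ≤ e := by
    by_contra hc
    rw [hb.cnfCoeff_eq_zero (not_le.1 hc)] at he
    omega
  have hc (e' : Ordinal.{u}) : cnfCoeff b e' = cnfCoeff c e' + if e' = a then 1 else 0 := by
    conv_lhs => rw [hb.1]
    rw [cnfCoeff_naturalSum, cnfCoeff_omega0_opow]
  have above (e' : Ordinal.{u}) (h : e < e') : cnfCoeff t e' = cnfCoeff c e' := by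
    rw [habove e' h, hc, if_neg (hae.trans_lt h).ne', add_zero]
  by_cases hlt : cnfCoeff t e < cnfCoeff c e
  · exact ⟨0, hpos, by rw [naturalSum_zero]; exact (lt_of_cnfCoeff_lt hlt above).le⟩
  · have hea : e = a := by
      by_contra h
      rw [hc, if_neg h] at he
      omega
    subst hea
    have heq : cnfCoeff t e = cnfCoeff c e := by
      rw [hc, if_pos rfl] at he
      omega
    obtain ⟨r, hr⟩ := exists_cnfCoeff_eq (fun e' => if e' < e then cnfCoeff t e' else 0)
      ((finite_cnfCoeff_ne_zero t).subset fun e' he' => by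
        by_cases h : e' < e <;> simp_all)
    refine ⟨r, lt_omega0_opow_iff.2 fun e' he' => by rw [hr, if_neg he'.not_gt], ?_⟩
    refine (cnfCoeff_ext fun e' => ?_).le
    rw [cnfCoeff_naturalSum, hr]
    rcases lt_trichotomy e' e with h | rfl | h
    · rw [if_pos h, hb.2 e' h, zero_add]
    · simp [heq]
    · rw [if_neg h.not_gt, above e' h, add_zero]

theorem base_naturalSum_lt {b r : Ordinal.{u}} (hb : b ≠ 0) (hr : r < ω ^ lastExp b) :
    base b ♯ r < b := by
  conv_rhs => rw [(isTail_base hb).1]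
  exact naturalSum_lt_naturalSum_right _ hr

/-- The last exponent of `c` is at least that of `b`, the ordinal `0` having last exponent
infinity. -/
def TailLE (b c : Ordinal.{u}) : Prop :=
  b ≠ 0 ∧ (c ≠ 0 → lastExp b ≤ lastExp c)

theorem tailLE_total {b c : Ordinal.{u}} (h : b ≠ 0 ∨ c ≠ 0) : TailLE b c ∨ TailLE c b := by
  by_cases hb : b = 0
  · exact Or.inr ⟨h.resolve_left (not_not.2 hb), fun h => absurd hb h⟩
  by_cases hc : c = 0
  · exact Or.inl ⟨hb, fun h => absurd hc h⟩
  rcases le_total (lastExp b) (lastExp c) with h | h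
  · exact Or.inl ⟨hb, fun _ => h⟩
  · exact Or.inr ⟨hc, fun _ => h⟩

theorem TailLE.isTail_naturalSum {b c : Ordinal.{u}} (h : TailLE b c) :
    IsTail (b ♯ c) (base b ♯ c) (lastExp b) := by
  have hb := isTail_base h.1
  refine ⟨?_, fun e he => ?_⟩
  · conv_lhs => rw [hb.1]
    ac_rfl
  · rw [cnfCoeff_naturalSum, hb.2 e he, zero_add]
    by_cases hc : c = 0
    · rw [hc, cnfCoeff_zero]
    · exact (isTail_base hc).cnfCoeff_eq_zero (he.trans_le (h.2 hc))

/-- Lowering both summands costs both last terms, while the remainders gained are below the larger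
of them, `ω ^ lastExp c`. This makes the error term in the product expansion negligible. -/
theorem TailLE.naturalSum_lt {b c b' c' : Ordinal.{u}} (h : TailLE b c) (hb : b' < b)
    (hc : c' < c) : b' ♯ c' < base b ♯ c := by
  have hc0 : c ≠ 0 := ne_bot_of_gt hc
  obtain ⟨r, hr, hbr⟩ := exists_le_base_naturalSum hb
  obtain ⟨s, hs, hcs⟩ := exists_le_base_naturalSum hc
  refine (naturalSum_le_naturalSum hbr hcs).trans_lt ?_
  have hr' : r < ω ^ lastExp c := hr.trans_le (opow_le_opow_right omega0_pos (h.2 hc0))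
  calc base b ♯ r ♯ (base c ♯ s) = base b ♯ base c ♯ (r ♯ s) := by ac_rfl
    _ < base b ♯ base c ♯ ω ^ lastExp c :=
      naturalSum_lt_naturalSum_right _ (naturalSum_lt_omega0_opow hr' hs)
    _ = base b ♯ c := by
      conv_rhs => rw [(isTail_base hc0).1]
      ac_rfl

/-- When the last exponents differ, lowering `c` alone already costs more than the whole last term
of `b`. -/
theorem TailLE.naturalSum_lt_of_lt {b c c' : Ordinal.{u}} (h : TailLE b c)
    (hne : lastExp b ≠ lastExp c) (hc : c' < c) : b ♯ c' < base b ♯ c := by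
  have hc0 : c ≠ 0 := ne_bot_of_gt hc
  obtain ⟨s, hs, hcs⟩ := exists_le_base_naturalSum hc
  have hb := isTail_base h.1
  refine (naturalSum_le_naturalSum le_rfl hcs).trans_lt ?_
  have hr' : ω ^ lastExp b < ω ^ lastExp c :=
    (opow_lt_opow_iff_right one_lt_omega0).2 ((h.2 hc0).lt_of_ne hne)
  calc b ♯ (base c ♯ s) = base b ♯ base c ♯ (ω ^ lastExp b ♯ s) := by
        conv_lhs => rw [hb.1]
        ac_rfl
    _ < base b ♯ base c ♯ ω ^ lastExp c :=
      naturalSum_lt_naturalSum_right _ (naturalSum_lt_omega0_opow hr' hs)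
    _ = base b ♯ c := by
      conv_rhs => rw [(isTail_base hc0).1]
      ac_rfl

/-! ### Natural sums with `-∞` -/

theorem bot_naturalSumBot (a : WithBot Ordinal.{u}) : ⊥ ♯ᵇ a = ⊥ := rfl

theorem naturalSumBot_bot (a : WithBot Ordinal.{u}) : a ♯ᵇ ⊥ = ⊥ := by
  cases a <;> rfl

theorem coe_naturalSumBot_coe (a b : Ordinal.{u}) :
    (a : WithBot Ordinal.{u}) ♯ᵇ b = ((a ♯ b : Ordinal.{u}) : WithBot Ordinal.{u}) := rfl

theorem naturalSumBot_comm (a b : WithBot Ordinal.{u}) : a ♯ᵇ b = b ♯ᵇ a := by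
  cases a <;> cases b <;> try rfl
  rw [coe_naturalSumBot_coe, coe_naturalSumBot_coe, naturalSum_comm]

theorem naturalSumBot_assoc (a b c : WithBot Ordinal.{u}) : a ♯ᵇ b ♯ᵇ c = a ♯ᵇ (b ♯ᵇ c) := by
  cases a <;> cases b <;> cases c <;> try rfl
  simp only [coe_naturalSumBot_coe, naturalSum_assoc]

instance : Std.Commutative
    (naturalSumBot : WithBot Ordinal.{u} → WithBot Ordinal.{u} → WithBot Ordinal.{u}) :=
  ⟨naturalSumBot_comm⟩

instance : Std.Associative
    (naturalSumBot : WithBot Ordinal.{u} → WithBot Ordinal.{u} → WithBot Ordinal.{u}) :=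
  ⟨naturalSumBot_assoc⟩

theorem naturalSumBot_le_naturalSumBot {a b c d : WithBot Ordinal.{u}} (h : a ≤ b) (h' : c ≤ d) :
    a ♯ᵇ c ≤ b ♯ᵇ d := by
  cases a with
  | bot => exact bot_le
  | coe a =>
    cases c with
    | bot => rw [naturalSumBot_bot]; exact bot_le
    | coe c =>
      cases b with
      | bot => simp at h
      | coe b =>
        cases d with
        | bot => simp at h'
        | coe d =>
          rw [coe_naturalSumBot_coe, coe_naturalSumBot_coe]
          exact_mod_cast naturalSum_le_naturalSum (by exact_mod_cast h) (by exact_mod_cast h')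

theorem naturalSumBot_lt_naturalSumBot_of_lt_of_le {a b c d : WithBot Ordinal.{u}} (h : a < b)
    (h' : c ≤ d) (hd : d ≠ ⊥) : a ♯ᵇ c < b ♯ᵇ d := by
  lift b to Ordinal.{u} using ne_bot_of_gt h
  lift d to Ordinal.{u} using hd
  rw [coe_naturalSumBot_coe]
  cases a with
  | bot => exact WithBot.bot_lt_coe _
  | coe a =>
    cases c with
    | bot => rw [naturalSumBot_bot]; exact WithBot.bot_lt_coe _
    | coe c =>
      rw [coe_naturalSumBot_coe]
      norm_cast at *
      exact (naturalSum_le_naturalSum le_rfl h').trans_lt (naturalSum_lt_naturalSum_left d h)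

theorem naturalSumBot_lt_naturalSumBot_of_le_of_lt {a b c d : WithBot Ordinal.{u}} (h : a ≤ b)
    (h' : c < d) (hb : b ≠ ⊥) : a ♯ᵇ c < b ♯ᵇ d := by
  rw [naturalSumBot_comm a, naturalSumBot_comm b]
  exact naturalSumBot_lt_naturalSumBot_of_lt_of_le h' h hb

/-- Used over `ℂ`, where only the doubled local degrees are computed directly. -/
theorem naturalSumBot_self_injective {a b : WithBot Ordinal.{u}} (h : a ♯ᵇ a = b ♯ᵇ b) : a = b := by
  rcases lt_trichotomy a b with hlt | heq | hlt
  · exact absurd h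
      (naturalSumBot_lt_naturalSumBot_of_lt_of_le hlt hlt.le (ne_bot_of_gt hlt)).ne
  · exact heq
  · exact absurd h
      (naturalSumBot_lt_naturalSumBot_of_lt_of_le hlt hlt.le (ne_bot_of_gt hlt)).ne'

/-! ### Order types and degrees of restrictions of series -/

section OrderType

variable {K : Type u} [Zero K] {K' : Type v} [Zero K']

/-- The series obtained by dropping the terms with exponents outside `s`. -/
def restrict (s : Set ℝ) (f : HahnSeries ℝ K) : HahnSeries ℝ K where
  coeff := s.indicator f.coeff
  isPWO_support' := f.isPWO_support.mono
    (Set.support_indicator.trans_subset Set.inter_subset_right)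

theorem coeff_restrict_of_mem {s : Set ℝ} (f : HahnSeries ℝ K) {x : ℝ} (h : x ∈ s) :
    (restrict s f).coeff x = f.coeff x := Set.indicator_of_mem h _

theorem coeff_restrict_of_notMem {s : Set ℝ} (f : HahnSeries ℝ K) {x : ℝ} (h : x ∉ s) :
    (restrict s f).coeff x = 0 := Set.indicator_of_notMem h _

theorem support_restrict (s : Set ℝ) (f : HahnSeries ℝ K) :
    (restrict s f).support = s ∩ f.support := Set.support_indicator

theorem restrict_eq_self {s : Set ℝ} {f : HahnSeries ℝ K} (h : f.support ⊆ s) :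
    restrict s f = f := HahnSeries.ext (Set.indicator_eq_self.2 h)

theorem orderType_mono {f : HahnSeries ℝ K} {g : HahnSeries ℝ K'} (h : f.support ⊆ g.support) :
    orderType f ≤ orderType g :=
  type_le_iff'.2 ⟨RelEmbedding.ofMonotone (Set.inclusion h) fun _ _ hab => hab⟩

theorem orderType_eq_zero_iff {f : HahnSeries ℝ K} : orderType f = 0 ↔ f = 0 := by
  rw [orderType, type_eq_zero_iff_isEmpty, Set.isEmpty_coe_sort, HahnSeries.support_eq_empty_iff]

theorem orderType_eq_add {f g h : HahnSeries ℝ K} (hs : f.support = g.support ∪ h.support)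
    (hlt : ∀ x ∈ g.support, ∀ y ∈ h.support, x < y) :
    orderType f = orderType g + orderType h := by
  have hg : g.support ⊆ f.support := hs ▸ Set.subset_union_left
  have hh : h.support ⊆ f.support := hs ▸ Set.subset_union_right
  rw [orderType, orderType, orderType, ← type_sum_lex]
  refine (type_eq.2 ⟨RelIso.ofSurjective (RelEmbedding.ofMonotone
    (Sum.elim (Set.inclusion hg) (Set.inclusion hh)) ?_) ?_⟩).symm
  · rintro _ _ (⟨hab⟩ | ⟨hab⟩ | ⟨a, b⟩)
    · assumption
    · assumption
    · exact hlt _ a.2 _ b.2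
  · rintro ⟨x, hx⟩
    rcases hs ▸ hx with hx' | hx'
    · exact ⟨Sum.inl ⟨x, hx'⟩, rfl⟩
    · exact ⟨Sum.inr ⟨x, hx'⟩, rfl⟩

theorem orderType_restrict_eq_add {s t r : Set ℝ} (f : HahnSeries ℝ K) (hs : s = t ∪ r)
    (hlt : ∀ x ∈ t, ∀ y ∈ r, x < y) :
    orderType (restrict s f) = orderType (restrict t f) + orderType (restrict r f) := by
  refine orderType_eq_add ?_ fun x hx y hy => ?_
  · simp only [support_restrict, hs, Set.union_inter_distrib_right]
  · rw [support_restrict] at hx hy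
    exact hlt x hx.1 y hy.1

theorem orderType_le_of_forall {f : HahnSeries ℝ K} {o : Ordinal}
    (h : ∀ x ∈ f.support, orderType (restrict (Set.Iio x) f) < o) : orderType f ≤ o := by
  refine le_of_forall_lt fun c hc => ?_
  obtain ⟨⟨x, hx⟩, rfl⟩ := typein_surj _ hc
  refine lt_of_le_of_lt ?_ (h x hx)
  change typein (fun a b : f.support => a < b) ⟨x, hx⟩ ≤ _
  rw [← type_subrel, orderType]
  refine type_le_iff'.2 ⟨RelEmbedding.ofMonotone (fun a => ⟨a.1.1, ?_⟩) fun a b hab => hab⟩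
  rw [support_restrict]
  exact ⟨a.2, a.1.2⟩

theorem orderType_restrict_mono {s t : Set ℝ} (f : HahnSeries ℝ K)
    (h : ∀ x ∈ s, f.coeff x ≠ 0 → x ∈ t) :
    orderType (restrict s f) ≤ orderType (restrict t f) := by
  refine orderType_mono fun x hx => ?_
  rw [support_restrict] at *
  exact ⟨h x hx.1 hx.2, hx.2⟩

theorem ordinalDegree_eq_bot_iff {a : Ordinal.{u}} : ordinalDegree a = ⊥ ↔ a = 0 := by
  unfold ordinalDegree
  split_ifs with h <;> simp [h]

theorem ordinalDegree_lt_coe_iff {a b : Ordinal.{u}} : ordinalDegree a < b ↔ a < ω ^ b := by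
  unfold ordinalDegree
  split_ifs with h
  · subst h
    simp [opow_pos]
  · rw [WithBot.coe_lt_coe, lt_opow_iff_log_lt one_lt_omega0 h]

theorem ordinalDegree_mono : Monotone (ordinalDegree : Ordinal.{u} → WithBot Ordinal.{u}) := by
  intro a b hab
  exact (isGreatest_ordinalDegree b).2 ((isGreatest_ordinalDegree a).1.trans hab)

theorem degree_mono {f : HahnSeries ℝ K} {g : HahnSeries ℝ K'} (h : f.support ⊆ g.support) :
    degree f ≤ degree g := ordinalDegree_mono (orderType_mono h)

theorem degree_eq_bot_iff {f : HahnSeries ℝ K} : degree f = ⊥ ↔ f = 0 :=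
  ordinalDegree_eq_bot_iff.trans orderType_eq_zero_iff

theorem degree_lt_coe_iff {f : HahnSeries ℝ K} {b : Ordinal} :
    degree f < b ↔ orderType f < ω ^ b := ordinalDegree_lt_coe_iff

end OrderType

theorem le_coe_iff_lt_add_one {d : WithBot Ordinal.{u}} {b : Ordinal.{u}} :
    d ≤ b ↔ d < ((b + 1 : Ordinal.{u}) : WithBot Ordinal.{u}) := by
  cases d with
  | bot => simp
  | coe d => norm_cast; exact (Order.lt_add_one_iff).symm

/-! ### The local degree -/

section LocalDegree

variable {K : Type u} [Zero K] {K' : Type v} [Zero K']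

/-- The degree of a series near `x` from the left: the least degree of the parts of the series
with exponents in the intervals `(y, x]`, for `y < x`. -/
def localDegree (f : HahnSeries ℝ K) (x : ℝ) : WithBot Ordinal.{0} :=
  sInf ((fun y => degree (restrict (Set.Ioc y x) f)) '' Set.Iio x)

theorem localDegree_le_degree_restrict (f : HahnSeries ℝ K) {x y : ℝ} (h : y < x) :
    localDegree f x ≤ degree (restrict (Set.Ioc y x) f) :=
  csInf_le (OrderBot.bddBelow _) ⟨y, h, rfl⟩

theorem exists_degree_restrict_eq (f : HahnSeries ℝ K) (x : ℝ) :
    ∃ y < x, degree (restrict (Set.Ioc y x) f) = localDegree f x := by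
  obtain ⟨y, hy, h⟩ := csInf_mem (s := (fun y => degree (restrict (Set.Ioc y x) f)) '' Set.Iio x)
    (Set.nonempty_Iio.image _)
  exact ⟨y, hy, h⟩

theorem localDegree_le_degree (f : HahnSeries ℝ K) (x : ℝ) : localDegree f x ≤ degree f := by
  refine (localDegree_le_degree_restrict f (sub_one_lt x)).trans (degree_mono ?_)
  rw [support_restrict]
  exact Set.inter_subset_right

theorem localDegree_eq_bot_iff {f : HahnSeries ℝ K} {x : ℝ} :
    localDegree f x = ⊥ ↔ ∃ y < x, ∀ u ∈ Set.Ioc y x, f.coeff u = 0 := by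
  have key (y : ℝ) : degree (restrict (Set.Ioc y x) f) = ⊥ ↔
      ∀ u ∈ Set.Ioc y x, f.coeff u = 0 := by
    rw [degree_eq_bot_iff]
    refine ⟨fun h u hu => ?_, fun h => HahnSeries.ext (funext fun u => ?_)⟩
    · rw [← coeff_restrict_of_mem f hu, h, HahnSeries.coeff_zero]
    · by_cases hu : u ∈ Set.Ioc y x
      · rw [coeff_restrict_of_mem f hu, h u hu, HahnSeries.coeff_zero]
      · rw [coeff_restrict_of_notMem f hu, HahnSeries.coeff_zero]
  constructor
  · intro h
    obtain ⟨y, hy, he⟩ := exists_degree_restrict_eq f x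
    exact ⟨y, hy, (key y).1 (he.trans h)⟩
  · rintro ⟨y, hy, h⟩
    exact le_bot_iff.1 ((localDegree_le_degree_restrict f hy).trans ((key y).2 h).le)

theorem localDegree_eq_bot_of_forall_le {f : HahnSeries ℝ K} {x y : ℝ} (hyx : y < x)
    (h : ∀ u, y < u → u ≤ x → f.coeff u = 0) : localDegree f x = ⊥ :=
  localDegree_eq_bot_iff.2 ⟨y, hyx, fun u hu => h u hu.1 hu.2⟩

theorem localDegree_ne_bot_of_coeff {f : HahnSeries ℝ K} {x : ℝ} (h : f.coeff x ≠ 0) :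
    localDegree f x ≠ ⊥ := by
  intro hc
  obtain ⟨y, hy, hu⟩ := localDegree_eq_bot_iff.1 hc
  exact h (hu x ⟨hy, le_rfl⟩)

/-- The support of a series has a gap to the right of every real number. -/
theorem exists_gap (f : HahnSeries ℝ K) (x : ℝ) :
    ∃ w > x, ∀ u ∈ Set.Ioc x w, f.coeff u = 0 := by
  by_cases hne : (f.support ∩ Set.Ioi x).Nonempty
  · have hwf : (f.support ∩ Set.Ioi x).IsWF := f.isWF_support.mono Set.inter_subset_left
    have hm := hwf.min_mem hne
    set m := hwf.min hne
    have hmx : x < m := hm.2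
    refine ⟨(x + m) / 2, by linarith, fun u hu => ?_⟩
    by_contra hc
    have hmu := hwf.min_le hne (a := u) ⟨hc, hu.1⟩
    have : m ≤ u := hmu
    linarith [hu.2]
  · refine ⟨x + 1, by linarith, fun u hu => ?_⟩
    by_contra hc
    exact hne ⟨u, hc, hu.1⟩

theorem exists_gap_localDegree (f : HahnSeries ℝ K) (x : ℝ) :
    ∃ w > x, ∀ u ∈ Set.Ioc x w, localDegree f u = ⊥ := by
  obtain ⟨w, hw, h⟩ := exists_gap f x
  exact ⟨w, hw, fun u hu => localDegree_eq_bot_of_forall_le hu.1 fun v hv hvu =>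
    h v ⟨hv, hvu.trans hu.2⟩⟩

theorem exists_forall_coeff_eq_zero (f : HahnSeries ℝ K) : ∃ y, ∀ u < y, f.coeff u = 0 := by
  by_cases hne : f.support.Nonempty
  · refine ⟨f.isWF_support.min hne, fun u hu => ?_⟩
    by_contra hc
    exact (f.isWF_support.min_le hne hc).not_gt hu
  · refine ⟨0, fun u _ => ?_⟩
    by_contra hc
    exact hne ⟨u, hc⟩

theorem exists_forall_localDegree_eq_bot (f : HahnSeries ℝ K) :
    ∃ y, ∀ u < y, localDegree f u = ⊥ := by
  obtain ⟨y, hy⟩ := exists_forall_coeff_eq_zero f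
  exact ⟨y, fun u hu => localDegree_eq_bot_of_forall_le (sub_one_lt u) fun v _ hvu =>
    hy v (hvu.trans_lt hu)⟩

/-- The points of local degree other than `⊥` are bounded below and leave a gap to the right of
every real number, so an infimum of such points is attained. -/
theorem exists_isLeast_of_localDegree_ne_bot (f : HahnSeries ℝ K) {s : Set ℝ} (hs : s.Nonempty)
    (h : ∀ u ∈ s, localDegree f u ≠ ⊥) : ∃ m, IsLeast s m := by
  obtain ⟨y, hy⟩ := exists_forall_localDegree_eq_bot f
  have hb : BddBelow s := ⟨y, fun u hu => not_lt.1 fun hc => h u hu (hy u hc)⟩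
  obtain ⟨w, hw, hgap⟩ := exists_gap_localDegree f (sInf s)
  obtain ⟨t, ht, htw⟩ := exists_lt_of_csInf_lt hs hw
  rcases (csInf_le hb ht).eq_or_lt with heq | hlt
  · exact ⟨t, ht, fun u hu => heq ▸ csInf_le hb hu⟩
  · exact absurd (hgap t ⟨hlt, htw.le⟩) (h t ht)

/-- From local to global: at the first `m` where the order type reaches `ω ^ b`, the interval splits
into a part ending before `m` and a short part near `m`. Both have type below `ω ^ b`, which is
additively indecomposable. -/
theorem orderType_restrict_Ioc_lt {f : HahnSeries ℝ K} {y v : ℝ} {b : Ordinal}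
    (h : ∀ u ∈ Set.Ioc y v, localDegree f u < b) :
    orderType (restrict (Set.Ioc y v) f) < ω ^ b := by
  have hpos : (0 : Ordinal) < ω ^ b := opow_pos _ omega0_pos
  have hempty {p q : ℝ} (hpq : q ≤ p) : orderType (restrict (Set.Ioc p q) f) = 0 := by
    rw [orderType_eq_zero_iff, ← HahnSeries.support_eq_empty_iff, support_restrict,
      Set.Ioc_eq_empty hpq.not_gt, Set.empty_inter]
  by_contra hv
  set T := {t | t ∈ Set.Ioc y v ∧ ω ^ b ≤ orderType (restrict (Set.Ioc y t) f)}
  have hyv : y < v := by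
    by_contra hc
    exact hv ((hempty (not_lt.1 hc)).trans_lt hpos)
  have hT : T.Nonempty := ⟨v, ⟨hyv, le_rfl⟩, not_lt.1 hv⟩
  have hTb : BddBelow T := ⟨y, fun t ht => ht.1.1.le⟩
  set m := sInf T
  -- The gap to the right of `m` shows that the infimum belongs to `T`.
  obtain ⟨w, hw, hgap⟩ := exists_gap f m
  obtain ⟨t, ht, htw⟩ := exists_lt_of_csInf_lt hT hw
  have hm : ω ^ b ≤ orderType (restrict (Set.Ioc y m) f) := by
    refine ht.2.trans (orderType_restrict_mono f fun x hx hx0 => ⟨hx.1, ?_⟩)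
    by_contra hc
    exact hx0 (hgap x ⟨not_le.1 hc, hx.2.trans htw.le⟩)
  have hym : y < m := by
    by_contra hc
    exact hm.not_gt ((hempty (not_lt.1 hc)).trans_lt hpos)
  have hmv : m ≤ v := csInf_le hTb ⟨⟨hyv, le_rfl⟩, not_lt.1 hv⟩
  obtain ⟨z, hz, hzd⟩ := exists_degree_restrict_eq f m
  have hz' : orderType (restrict (Set.Ioc z m) f) < ω ^ b :=
    degree_lt_coe_iff.1 (hzd ▸ h m ⟨hym, hmv⟩)
  rcases le_or_gt z y with hzy | hyz
  · have hle : orderType (restrict (Set.Ioc y m) f) ≤ orderType (restrict (Set.Ioc z m) f) :=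
      orderType_restrict_mono f fun x hx _ => ⟨hzy.trans_lt hx.1, hx.2⟩
    exact (hm.trans hle).not_gt hz'
  · have hyz' : orderType (restrict (Set.Ioc y z) f) < ω ^ b := by
      by_contra hc
      exact (csInf_le hTb ⟨⟨hyz, hz.le.trans hmv⟩, not_lt.1 hc⟩ : m ≤ z).not_gt hz
    rw [orderType_restrict_eq_add f (Set.Ioc_union_Ioc_eq_Ioc hyz.le hz.le).symm
      fun p hp q hq => hp.2.trans_lt hq.1] at hm
    exact hm.not_gt (isPrincipal_add_omega0_opow b hyz' hz')

/-- The recursive description of the local degree, on which the later inductions on ordinals rest.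
-/
theorem localDegree_le_coe_iff {f : HahnSeries ℝ K} {x : ℝ} {b : Ordinal} :
    localDegree f x ≤ b ↔ ∃ y < x, ∀ u ∈ Set.Ioo y x, localDegree f u < b := by
  constructor
  · intro h
    obtain ⟨y₀, hy₀, hd⟩ := exists_degree_restrict_eq f x
    have h₀ : orderType (restrict (Set.Ioc y₀ x) f) < ω ^ (b + 1) := by
      rw [← degree_lt_coe_iff, ← le_coe_iff_lt_add_one, hd]
      exact h
    -- The order type of `(y, x)` decreases as `y` approaches `x`, so it is constant from some `y₁`
    -- on.
    obtain ⟨y₁, hy₁, hmin⟩ := csInf_mem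
      (s := (fun y => orderType (restrict (Set.Ioo y x) f)) '' Set.Iio x)
      (Set.nonempty_Iio.image _)
    have hmin' (y : ℝ) (hy : y < x) :
        orderType (restrict (Set.Ioo y₁ x) f) ≤ orderType (restrict (Set.Ioo y x) f) :=
      hmin.trans_le (csInf_le (OrderBot.bddBelow _) ⟨y, hy, rfl⟩)
    refine ⟨max y₀ y₁, max_lt hy₀ hy₁, fun u hu => ?_⟩
    set y := max y₀ y₁
    refine (localDegree_le_degree_restrict f hu.1).trans_lt (degree_lt_coe_iff.2 ?_)
    by_contra hc
    have hle : orderType (restrict (Set.Ioo y x) f) ≤ orderType (restrict (Set.Ioo y₁ x) f) :=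
      orderType_restrict_mono f fun p hp _ => ⟨(le_max_right y₀ y₁).trans_lt hp.1, hp.2⟩
    have heq := hle.trans (hmin' u hu.2)
    -- With `A` the type of `(y, u]` and `B` that of `(u, x)`, minimality gives `A + B ≤ B`, hence
    -- `A * ω ≤ B`. As `ω ^ b ≤ A`, this forces `ω ^ (b + 1) ≤ B`, which is too large.
    rw [orderType_restrict_eq_add f (Set.Ioc_union_Ioo_eq_Ioo hu.1.le hu.2).symm
      fun p hp q hq => hp.2.trans_lt hq.1, add_le_right_iff_mul_omega0_le] at heq
    refine (h₀.trans_le ?_).false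
    rw [opow_add, opow_one]
    refine (mul_le_mul_left (not_lt.1 hc) ω).trans (heq.trans
      (orderType_restrict_mono f fun p hp _ => ?_))
    exact ⟨((le_max_left y₀ y₁).trans_lt hu.1).trans hp.1, hp.2.le⟩
  · rintro ⟨y, hy, h⟩
    refine (localDegree_le_degree_restrict f hy).trans ?_
    rw [le_coe_iff_lt_add_one, degree_lt_coe_iff]
    have h1 (v : ℝ) (hv : v ≤ x) : orderType (restrict (Set.Ioo y v) f) ≤ ω ^ b := by
      refine orderType_le_of_forall fun p hp => ?_
      rw [support_restrict] at hp
      refine lt_of_le_of_lt (orderType_mono ?_)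
        (orderType_restrict_Ioc_lt fun u hu => h u ⟨hu.1, hu.2.trans_lt (hp.1.2.trans_le hv)⟩)
      simp only [support_restrict]
      exact fun q hq => ⟨⟨hq.2.1.1, le_of_lt hq.1⟩, hq.2.2⟩
    -- The extra `1` accounts for the exponent `x` itself.
    have h2 : orderType (restrict (Set.Ioc y x) f) ≤ ω ^ b + 1 := by
      refine orderType_le_of_forall fun p hp => ?_
      rw [support_restrict] at hp
      refine Order.lt_add_one_iff.2 (le_trans (orderType_mono ?_) (h1 p hp.1.2))
      simp only [support_restrict]
      exact fun q hq => ⟨⟨hq.2.1.1, hq.1⟩, hq.2.2⟩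
    refine h2.trans_lt ?_
    have hb : ω ^ b < ω ^ (b + 1) :=
      (opow_lt_opow_iff_right one_lt_omega0).2 (Order.lt_add_one_iff.2 le_rfl)
    refine isPrincipal_add_omega0_opow _ hb (lt_of_le_of_lt ?_ hb)
    exact Order.one_le_iff_pos.2 (opow_pos _ omega0_pos)

theorem degree_lt_coe_of_forall {f : HahnSeries ℝ K} {x : ℝ} (hf : f.support ⊆ Set.Iic x)
    {b : Ordinal} (h : ∀ u, localDegree f u < b) : degree f < b := by
  obtain ⟨y, hy⟩ := exists_forall_coeff_eq_zero f
  rw [degree_lt_coe_iff]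
  refine (orderType_mono fun u hu => ?_).trans_lt
    (orderType_restrict_Ioc_lt (y := y - 1) (v := x) fun u _ => h u)
  rw [support_restrict]
  refine ⟨⟨?_, hf hu⟩, hu⟩
  by_contra hc
  exact hu (hy u (by linarith))

/-- If all local degrees were smaller, the local-to-global bound would make the degree smaller than
itself. -/
theorem exists_localDegree_eq_degree {f : HahnSeries ℝ K} {x : ℝ} (hf : f.support ⊆ Set.Iic x) :
    ∃ u, localDegree f u = degree f := by
  by_contra! hne
  have hlt (u : ℝ) : localDegree f u < degree f := (localDegree_le_degree f u).lt_of_ne (hne u)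
  cases hd : degree f with
  | bot => exact (hd ▸ hlt x).not_ge bot_le
  | coe b => exact (degree_lt_coe_of_forall hf fun u => hd ▸ hlt u).ne hd

theorem exists_forall_localDegree_lt {f : HahnSeries ℝ K} {x : ℝ} (h : localDegree f x ≠ ⊥) :
    ∃ y < x, ∀ u ∈ Set.Ioo y x, localDegree f u < localDegree f x := by
  obtain ⟨b, hb⟩ := WithBot.ne_bot_iff_exists.1 h
  rw [← hb]
  exact localDegree_le_coe_iff.1 hb.symm.le

theorem exists_forall_localDegree_le (f : HahnSeries ℝ K) (x : ℝ) :
    ∃ y < x, ∀ u ∈ Set.Ioc y x, localDegree f u ≤ localDegree f x := by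
  obtain ⟨y, hy, h⟩ := exists_degree_restrict_eq f x
  refine ⟨y, hy, fun u hu => (localDegree_le_degree_restrict f hu.1).trans (h ▸ degree_mono ?_)⟩
  simp only [support_restrict]
  exact Set.inter_subset_inter_left _ (Set.Ioc_subset_Ioc_right hu.2)

theorem exists_lt_le_localDegree {f : HahnSeries ℝ K} {x y : ℝ} {t : Ordinal}
    (h : t < localDegree f x) (hy : y < x) : ∃ u ∈ Set.Ioo y x, t ≤ localDegree f u := by
  by_contra! hc
  exact h.not_ge (localDegree_le_coe_iff.2 ⟨y, hy, hc⟩)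

theorem localDegree_mono {f : HahnSeries ℝ K} {g : HahnSeries ℝ K'} (h : f.support ⊆ g.support)
    (x : ℝ) : localDegree f x ≤ localDegree g x := by
  obtain ⟨y, hy, he⟩ := exists_degree_restrict_eq g x
  rw [← he]
  refine (localDegree_le_degree_restrict f hy).trans (degree_mono ?_)
  simp only [support_restrict]
  exact Set.inter_subset_inter_right _ h

end LocalDegree

/-! ### Local degrees of sums and truncations -/

section Sums

variable {K : Type u} [AddCommGroup K]

/-- Induction on a common bound `b`: at points just left of `x` both local degrees are below `b`, so
their maximum is a smaller bound. -/
theorem localDegree_add_le (f g : HahnSeries ℝ K) (x : ℝ) :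
    localDegree (f + g) x ≤ max (localDegree f x) (localDegree g x) := by
  have hbot (x : ℝ) (hf : localDegree f x = ⊥) (hg : localDegree g x = ⊥) :
      localDegree (f + g) x = ⊥ := by
    obtain ⟨y, hy, h⟩ := localDegree_eq_bot_iff.1 hf
    obtain ⟨z, hz, h'⟩ := localDegree_eq_bot_iff.1 hg
    refine localDegree_eq_bot_of_forall_le (max_lt hy hz) fun u hu hux => ?_
    rw [HahnSeries.coeff_add, h u ⟨(le_max_left _ _).trans_lt hu, hux⟩,
      h' u ⟨(le_max_right _ _).trans_lt hu, hux⟩, add_zero]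
  have key (b : Ordinal) : ∀ x, localDegree f x ≤ b → localDegree g x ≤ b →
      localDegree (f + g) x ≤ b := by
    induction b using WellFoundedLT.induction with
    | ind b ih =>
      intro x hf hg
      obtain ⟨y, hy, h⟩ := localDegree_le_coe_iff.1 hf
      obtain ⟨z, hz, h'⟩ := localDegree_le_coe_iff.1 hg
      refine localDegree_le_coe_iff.2 ⟨max y z, max_lt hy hz, fun u hu => ?_⟩
      have hfu := h u ⟨(le_max_left _ _).trans_lt hu.1, hu.2⟩
      have hgu := h' u ⟨(le_max_right _ _).trans_lt hu.1, hu.2⟩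
      cases hd : max (localDegree f u) (localDegree g u) with
      | bot =>
        rw [max_eq_bot] at hd
        rw [hbot u hd.1 hd.2]
        exact WithBot.bot_lt_coe b
      | coe c =>
        have hc : (c : WithBot Ordinal) < b := hd ▸ max_lt hfu hgu
        exact (ih c (by exact_mod_cast hc) u (hd ▸ le_max_left _ _)
          (hd ▸ le_max_right _ _)).trans_lt hc
  cases hd : max (localDegree f x) (localDegree g x) with
  | bot =>
    rw [max_eq_bot] at hd
    rw [hbot x hd.1 hd.2]
  | coe c => exact key c x (hd ▸ le_max_left _ _) (hd ▸ le_max_right _ _)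

theorem localDegree_neg (f : HahnSeries ℝ K) (x : ℝ) :
    localDegree (-f) x = localDegree f x :=
  le_antisymm (localDegree_mono (by simp) x) (localDegree_mono (by simp) x)

theorem localDegree_sub_le (f g : HahnSeries ℝ K) (x : ℝ) :
    localDegree (f - g) x ≤ max (localDegree f x) (localDegree g x) := by
  rw [sub_eq_add_neg, ← localDegree_neg g]
  exact localDegree_add_le f (-g) x

theorem localDegree_eq_of_sub_lt {f g : HahnSeries ℝ K} {x : ℝ}
    (h : localDegree (f - g) x < localDegree f x) : localDegree g x = localDegree f x := by
  refine le_antisymm ?_ ?_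
  · have := localDegree_sub_le f (f - g) x
    rwa [sub_sub_cancel, max_eq_left h.le] at this
  · by_contra hc
    have := localDegree_add_le (f - g) g x
    rw [sub_add_cancel] at this
    exact this.not_gt (max_lt h (not_le.1 hc))

theorem localDegree_congr {f g : HahnSeries ℝ K} {x : ℝ} (h : localDegree (f - g) x = ⊥) :
    localDegree f x = localDegree g x := by
  refine le_antisymm ?_ ?_
  · have := localDegree_add_le (f - g) g x
    rwa [sub_add_cancel, h, max_eq_right bot_le] at this
  · have := localDegree_sub_le f (f - g) x
    rwa [sub_sub_cancel, h, max_eq_left bot_le] at this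

theorem restrict_Iic_add_restrict_Ioi (f : HahnSeries ℝ K) (w : ℝ) :
    restrict (Set.Iic w) f + restrict (Set.Ioi w) f = f := by
  ext x
  rw [HahnSeries.coeff_add]
  rcases le_or_gt x w with h | h
  · rw [coeff_restrict_of_mem f (Set.mem_Iic.2 h),
      coeff_restrict_of_notMem f (Set.notMem_Ioi.2 h), add_zero]
  · rw [coeff_restrict_of_mem f (Set.mem_Ioi.2 h),
      coeff_restrict_of_notMem f (Set.notMem_Iic.2 h), zero_add]

theorem localDegree_restrict_Ioi_of_le (f : HahnSeries ℝ K) {w x : ℝ} (h : x ≤ w) :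
    localDegree (restrict (Set.Ioi w) f) x = ⊥ :=
  localDegree_eq_bot_of_forall_le (sub_one_lt x) fun _ _ hu =>
    coeff_restrict_of_notMem f (not_lt.2 (hu.trans h))

theorem localDegree_restrict_Iic_of_lt (f : HahnSeries ℝ K) {w x : ℝ} (h : w < x) :
    localDegree (restrict (Set.Iic w) f) x = ⊥ :=
  localDegree_eq_bot_of_forall_le h fun _ hu _ => coeff_restrict_of_notMem f (not_le.2 hu)

theorem localDegree_restrict_Iic_of_le (f : HahnSeries ℝ K) {w x : ℝ} (h : x ≤ w) :
    localDegree (restrict (Set.Iic w) f) x = localDegree f x := by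
  refine (localDegree_congr ?_).symm
  rw [sub_eq_of_eq_add' (restrict_Iic_add_restrict_Ioi f w).symm]
  exact localDegree_restrict_Ioi_of_le f h

theorem localDegree_restrict_le (s : Set ℝ) (f : HahnSeries ℝ K) (x : ℝ) :
    localDegree (restrict s f) x ≤ localDegree f x :=
  localDegree_mono (by rw [support_restrict]; exact Set.inter_subset_right) x

theorem localDegree_eq_bot_of_support_subset {f : HahnSeries ℝ K} {w x : ℝ}
    (hf : f.support ⊆ Set.Iic w) (h : w < x) : localDegree f x = ⊥ := by
  rw [← restrict_eq_self hf]
  exact localDegree_restrict_Iic_of_lt f h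

end Sums

/-! ### Local degrees of products: the upper bound -/

/-- On the left this is the recursive description of the local degree, on the right it is the gap.
-/
theorem exists_forall_abs_sub_lt {K : Type u} [Zero K] (f : HahnSeries ℝ K) (x : ℝ) :
    ∃ r > 0, ∀ u, |u - x| < r → u ≠ x →
      localDegree f u = ⊥ ∨ localDegree f u < localDegree f x := by
  obtain ⟨w, hw, hgap⟩ := exists_gap_localDegree f x
  have hleft : ∃ y < x, ∀ u ∈ Set.Ioo y x,
      localDegree f u = ⊥ ∨ localDegree f u < localDegree f x := by
    by_cases h : localDegree f x = ⊥
    · obtain ⟨y, hy, hu⟩ := exists_forall_localDegree_le f x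
      exact ⟨y, hy, fun u hu' => Or.inl (le_bot_iff.1 (h ▸ hu u ⟨hu'.1, hu'.2.le⟩))⟩
    · obtain ⟨y, hy, hu⟩ := exists_forall_localDegree_lt h
      exact ⟨y, hy, fun u hu' => Or.inr (hu u hu')⟩
  obtain ⟨y, hy, hleft⟩ := hleft
  refine ⟨min (w - x) (x - y), lt_min (sub_pos.2 hw) (sub_pos.2 hy), fun u hu hne => ?_⟩
  obtain ⟨h1, h2⟩ := abs_lt.1 hu
  have h3 := min_le_left (w - x) (x - y)
  have h4 := min_le_right (w - x) (x - y)
  rcases lt_or_gt_of_ne hne with h | h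
  · exact hleft u ⟨by linarith, h⟩
  · exact Or.inl (hgap u ⟨h, by linarith⟩)

section Ring

variable {K : Type u} [Ring K]

theorem naturalSumBot_lt_of_ne {a b a' b' : WithBot Ordinal.{v}} {p q : Prop}
    (ha : p ∨ a' = ⊥ ∨ a' < a) (hap : p → a' = a) (hb : q ∨ b' = ⊥ ∨ b' < b) (hbq : q → b' = b)
    (hpq : ¬(p ∧ q)) : a' ♯ᵇ b' < a ♯ᵇ b ∨ a' ♯ᵇ b' = ⊥ := by
  by_cases ha' : a' = ⊥
  · exact Or.inr (ha' ▸ bot_naturalSumBot b')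
  by_cases hb' : b' = ⊥
  · exact Or.inr (hb' ▸ naturalSumBot_bot a')
  refine Or.inl ?_
  rcases ha with hp | h | hlt
  · rcases hb with hq | h | hlt'
    · exact absurd ⟨hp, hq⟩ hpq
    · exact absurd h hb'
    · exact naturalSumBot_lt_naturalSumBot_of_le_of_lt (hap hp).le hlt' (hap hp ▸ ha')
  · exact absurd h ha'
  · rcases hb with hq | h | hlt'
    · exact naturalSumBot_lt_naturalSumBot_of_lt_of_le hlt (hbq hq).le (hbq hq ▸ hb')
    · exact absurd h hb'
    · exact naturalSumBot_lt_naturalSumBot_of_lt_of_le hlt hlt'.le (ne_bot_of_gt hlt')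

/-- The degrees of `f` and `g` at pairs of points with sum near `x` are bounded by a value that is
attained at a pair with sum `x`. -/
theorem exists_bound_naturalSumBot_localDegree (f g : HahnSeries ℝ K) (x : ℝ)
    {t : WithBot Ordinal} (ht : t ≠ ⊥)
    (h : ∀ d, localDegree f d ♯ᵇ localDegree g (x - d) < t) :
    ∃ y < x, ∃ s < t, ∀ d e, y < d + e → d + e < x →
      localDegree f d ♯ᵇ localDegree g e < s ∨ localDegree f d ♯ᵇ localDegree g e = ⊥ := by
  obtain ⟨a, ha⟩ := exists_forall_localDegree_eq_bot f
  obtain ⟨c, hc⟩ := exists_forall_localDegree_eq_bot g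
  -- If `d < a` or `e < c`, one local degree is `⊥`; otherwise `d` lies in a compact interval and
  -- local bounds can be glued.
  have hcompact : ∃ y < x, ∃ s < t, ∀ d ∈ Set.Icc a (x - c), ∀ e, y < d + e → d + e < x →
      localDegree f d ♯ᵇ localDegree g e < s ∨ localDegree f d ♯ᵇ localDegree g e = ⊥ := by
    refine isCompact_Icc.induction_on (p := fun S => ∃ y < x, ∃ s < t, ∀ d ∈ S, ∀ e, y < d + e →
      d + e < x → localDegree f d ♯ᵇ localDegree g e < s ∨
        localDegree f d ♯ᵇ localDegree g e = ⊥) ?_ ?_ ?_ ?_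
    · exact ⟨x - 1, by linarith, ⊥, bot_lt_iff_ne_bot.2 ht, fun d hd => absurd hd (by simp)⟩
    · rintro S T hST ⟨y, hy, s, hs, H⟩
      exact ⟨y, hy, s, hs, fun d hd => H d (hST hd)⟩
    · rintro S T ⟨y, hy, s, hs, H⟩ ⟨y', hy', s', hs', H'⟩
      refine ⟨max y y', max_lt hy hy', max s s', max_lt hs hs', ?_⟩
      rintro d (hd | hd) e hde hdx
      · exact (H d hd e ((le_max_left _ _).trans_lt hde) hdx).imp_left
          fun h => h.trans_le (le_max_left _ _)
      · exact (H' d hd e ((le_max_right _ _).trans_lt hde) hdx).imp_left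
          fun h => h.trans_le (le_max_right _ _)
    · intro d _
      obtain ⟨r, hr, hf⟩ := exists_forall_abs_sub_lt f d
      obtain ⟨r', hr', hg⟩ := exists_forall_abs_sub_lt g (x - d)
      set ρ := min r (r' / 2)
      have hρ : 0 < ρ := lt_min hr (by linarith)
      have h1 : ρ ≤ r := min_le_left _ _
      have h2 : ρ ≤ r' / 2 := min_le_right _ _
      -- The point `e` is within `2 * ρ ≤ r'` of `x - d`. Since `d' + e < x`, the pair is not `(d, x
      -- - d)`, so at least one local degree drops and the value at `(d, x - d)` is a strict bound.
      refine ⟨Metric.ball d ρ, mem_nhdsWithin_of_mem_nhds (Metric.ball_mem_nhds d hρ),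
        x - ρ, by linarith, _, h d, fun d' hd' e hde hdx => ?_⟩
      rw [Metric.mem_ball, Real.dist_eq] at hd'
      refine naturalSumBot_lt_of_ne (p := d' = d) (q := e = x - d)
        (or_iff_not_imp_left.2 (hf d' (hd'.trans_le h1))) (fun h => by rw [h])
        (or_iff_not_imp_left.2 (hg e ?_)) (fun h => by rw [h]) ?_
      · rw [abs_lt] at *
        constructor <;> linarith
      · rintro ⟨rfl, rfl⟩
        linarith
  obtain ⟨y, hy, s, hs, H⟩ := hcompact
  refine ⟨y, hy, s, hs, fun d e hde hdx => ?_⟩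
  by_cases hd : d < a
  · exact Or.inr (by rw [ha d hd, bot_naturalSumBot])
  by_cases he : e < c
  · exact Or.inr (by rw [hc e he, naturalSumBot_bot])
  exact H d ⟨not_lt.1 hd, by linarith⟩ e hde hdx

/-- If no pair over `x` reached `t`, all pairs over points just left of `x` would stay below some `s
< t`. But the product reaches `s` at such points, and the induction hypothesis at `s` yields a pair
that does too. -/
theorem exists_le_naturalSumBot_localDegree (f g : HahnSeries ℝ K) (t : Ordinal) :
    ∀ x, t ≤ localDegree (f * g) x → ∃ d, t ≤ localDegree f d ♯ᵇ localDegree g (x - d) := by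
  induction t using WellFoundedLT.induction with
  | ind t ih =>
    intro x hx
    by_contra! hlt
    obtain ⟨y, hy, s, hs, H⟩ :=
      exists_bound_naturalSumBot_localDegree f g x WithBot.coe_ne_bot hlt
    -- `s` may be `⊥`, whereas the induction needs an ordinal.
    cases hs' : max s 0 with
    | bot => simp at hs'
    | coe r =>
      have hr0 : (0 : WithBot Ordinal) ≤ r := hs' ▸ le_max_right _ _
      -- For `t = 0` there is no smaller ordinal; an exponent of the product in `(y, x]` is used
      -- instead, being a sum of exponents of `f` and `g`.
      rcases eq_or_ne t 0 with rfl | ht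
      · have hne : localDegree (f * g) x ≠ ⊥ := by
          intro h
          rw [h] at hx
          simp at hx
        rw [ne_eq, localDegree_eq_bot_iff] at hne
        push Not at hne
        obtain ⟨u, hu, hcoeff⟩ := hne y hy
        obtain ⟨d, hd, e, he, rfl⟩ := HahnSeries.support_mul_subset hcoeff
        have hpos : (0 : WithBot Ordinal) ≤ localDegree f d ♯ᵇ localDegree g e := by
          obtain ⟨p, hp⟩ := WithBot.ne_bot_iff_exists.1 (localDegree_ne_bot_of_coeff hd)
          obtain ⟨q, hq⟩ := WithBot.ne_bot_iff_exists.1 (localDegree_ne_bot_of_coeff he)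
          rw [← hp, ← hq, coe_naturalSumBot_coe]
          exact_mod_cast zero_le
        rcases hu.2.eq_or_lt with hux | hux
        · refine (hlt d).not_ge ?_
          rw [← hux, add_sub_cancel_left]
          exact hpos
        · rcases H d e hu.1 hux with h | h
          · have := hs.trans_le (hpos.trans h.le)
            exact this.false
          · rw [h] at hpos
            simp at hpos
      · have hrt : r < t := by
          rw [← WithBot.coe_lt_coe, ← hs']
          exact max_lt hs (by exact_mod_cast pos_iff_ne_zero.2 ht)
        obtain ⟨u, hu, hru⟩ := exists_lt_le_localDegree
          (lt_of_lt_of_le (WithBot.coe_lt_coe.2 hrt) hx) hy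
        obtain ⟨d, hd⟩ := ih r hrt u hru
        rcases H d (u - d) (by linarith [hu.1]) (by linarith [hu.2]) with h | h
        · exact (hd.trans_lt (h.trans_le (hs' ▸ le_max_left s 0))).false
        · rw [h] at hd
          simp at hd

theorem exists_localDegree_mul_le (f g : HahnSeries ℝ K) (x : ℝ) :
    ∃ d, localDegree (f * g) x ≤ localDegree f d ♯ᵇ localDegree g (x - d) := by
  cases hx : localDegree (f * g) x with
  | bot => exact ⟨0, bot_le⟩
  | coe t => exact exists_le_naturalSumBot_localDegree f g t x hx.ge

theorem localDegree_mul_lt (f g : HahnSeries ℝ K) {x : ℝ} {t : WithBot Ordinal}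
    (h : ∀ d, localDegree f d ♯ᵇ localDegree g (x - d) < t) : localDegree (f * g) x < t := by
  obtain ⟨d, hd⟩ := exists_localDegree_mul_le f g x
  exact hd.trans_lt (h d)

theorem localDegree_mul_le_of_support_subset {f g : HahnSeries ℝ K} {x y : ℝ}
    (hf : f.support ⊆ Set.Iic x) (hg : g.support ⊆ Set.Iic y) :
    localDegree (f * g) (x + y) ≤ localDegree f x ♯ᵇ localDegree g y := by
  obtain ⟨d, hd⟩ := exists_localDegree_mul_le f g (x + y)
  rcases lt_trichotomy d x with h | rfl | h
  · rw [localDegree_eq_bot_of_support_subset hg (by linarith : y < x + y - d),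
      naturalSumBot_bot] at hd
    exact hd.trans bot_le
  · rwa [add_sub_cancel_left] at hd
  · rw [localDegree_eq_bot_of_support_subset hf h, bot_naturalSumBot] at hd
    exact hd.trans bot_le

theorem support_mul_subset_Iic {f g : HahnSeries ℝ K} {x y : ℝ}
    (hf : f.support ⊆ Set.Iic x) (hg : g.support ⊆ Set.Iic y) :
    (f * g).support ⊆ Set.Iic (x + y) := by
  intro z hz
  obtain ⟨p, hp, q, hq, rfl⟩ := HahnSeries.support_mul_subset hz
  exact Set.mem_Iic.2 (add_le_add (hf hp) (hg hq))

end Ring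

/-! ### Signs of series at a point -/

instance (a : Ordinal.{0}) : (Filter.map ((↑) : Set.Iio (ω ^ a) → Ordinal.{0}) Filter.atTop).NeBot :=
  have : Nonempty (Set.Iio (ω ^ a)) := ⟨⟨0, opow_pos _ omega0_pos⟩⟩
  inferInstance

/-- An ultrafilter of thresholds: its members `(z, r)` have `z < 0` tending to `0` and `r < ω ^ a`
tending to `ω ^ a`. -/
def thresholds (a : Ordinal.{0}) : Filter (ℝ × Ordinal.{0}) :=
  Ultrafilter.of (nhdsWithin (0 : ℝ) (Set.Iio 0) ×ˢ
    Filter.map ((↑) : Set.Iio (ω ^ a) → Ordinal.{0}) Filter.atTop)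

instance (a : Ordinal.{0}) : (thresholds a).NeBot := Ultrafilter.neBot _

/-- The reason for an ultrafilter: it decides between two signs that may alternate as the threshold
varies. -/
theorem eventually_thresholds_or {a : Ordinal.{0}} {p q : ℝ × Ordinal.{0} → Prop} :
    (∀ᶠ θ in thresholds a, p θ ∨ q θ) ↔
      (∀ᶠ θ in thresholds a, p θ) ∨ ∀ᶠ θ in thresholds a, q θ :=
  Ultrafilter.eventually_or

theorem eventually_thresholds {a r : Ordinal.{0}} {z : ℝ} (hz : z < 0) (hr : r < ω ^ a) :
    ∀ᶠ θ in thresholds a, z < θ.1 ∧ θ.1 < 0 ∧ r ≤ θ.2 ∧ θ.2 < ω ^ a := by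
  have h1 : ∀ᶠ t in nhdsWithin (0 : ℝ) (Set.Iio 0), z < t ∧ t < 0 := Ioo_mem_nhdsLT hz
  have h2 : ∀ᶠ t in Filter.map ((↑) : Set.Iio (ω ^ a) → Ordinal.{0}) Filter.atTop,
      r ≤ t ∧ t < ω ^ a := by
    rw [Filter.eventually_map]
    filter_upwards [Filter.eventually_ge_atTop (⟨r, hr⟩ : Set.Iio (ω ^ a))] with t ht
    exact ⟨ht, t.2⟩
  refine (Filter.Eventually.filter_mono (Ultrafilter.of_le _) (h1.prod_mk h2)).mono ?_
  rintro θ ⟨⟨h3, h4⟩, h5, h6⟩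
  exact ⟨h3, h4, h5, h6⟩

section Crossing

variable {K : Type u} [Zero K]

/-- The points in `(x + θ.1, x)` at which the local degree is at least `base b ♯ θ.2`. -/
def crossing (f : HahnSeries ℝ K) (x : ℝ) (b : Ordinal.{0}) (θ : ℝ × Ordinal.{0}) : Set ℝ :=
  {u | x + θ.1 < u ∧ u < x ∧ ((base b ♯ θ.2 : Ordinal.{0}) : WithBot Ordinal.{0}) ≤ localDegree f u}

/-- By cofinality some threshold dominates the local degree at `x`, and nearby points on the left do
not exceed it. -/
theorem eventually_localDegree_lt_base {f : HahnSeries ℝ K} {x : ℝ} {b : Ordinal}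
    (h : localDegree f x < b) : ∀ᶠ θ in thresholds (lastExp b), ∀ u, x + θ.1 < u → u < x →
      localDegree f u < ((base b ♯ θ.2 : Ordinal) : WithBot Ordinal) := by
  obtain ⟨η, hη, hnear⟩ := exists_forall_abs_sub_lt f x
  obtain ⟨r, hr, hle⟩ : ∃ r < ω ^ lastExp b,
      localDegree f x ≤ ((base b ♯ r : Ordinal) : WithBot Ordinal) := by
    cases hd : localDegree f x with
    | bot => exact ⟨0, opow_pos _ omega0_pos, bot_le⟩
    | coe t =>
      obtain ⟨r, hr, hle⟩ := exists_le_base_naturalSum (WithBot.coe_lt_coe.1 (hd ▸ h))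
      exact ⟨r, hr, WithBot.coe_le_coe.2 hle⟩
  filter_upwards [eventually_thresholds (neg_neg_of_pos hη) hr] with θ hθ u hu hux
  rcases hnear u (abs_lt.2 ⟨by linarith, by linarith⟩) hux.ne with h | h
  · rw [h]
    exact WithBot.bot_lt_coe _
  · exact h.trans_le (hle.trans (WithBot.coe_le_coe.2 (naturalSum_le_naturalSum le_rfl hθ.2.2.1)))

theorem eventually_localDegree_lt {f : HahnSeries ℝ K} {x : ℝ} {b : Ordinal}
    (h : localDegree f x = b) (a : Ordinal) : ∀ᶠ θ in thresholds a, ∀ u, x + θ.1 < u → u < x →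
      localDegree f u < b := by
  obtain ⟨y, hy, hlt⟩ := exists_forall_localDegree_lt (h ▸ WithBot.coe_ne_bot)
  filter_upwards [eventually_thresholds (sub_neg.2 hy) (opow_pos a omega0_pos)] with θ hθ u hu hux
  exact h ▸ hlt u ⟨by linarith [hθ.1], hux⟩

theorem eventually_crossing_nonempty {f : HahnSeries ℝ K} {x : ℝ} {b : Ordinal} (hb : b ≠ 0)
    (h : b ≤ localDegree f x) :
    ∀ᶠ θ in thresholds (lastExp b), (crossing f x b θ).Nonempty := by
  filter_upwards [eventually_thresholds (sub_one_lt 0) (opow_pos _ omega0_pos)] with θ hθ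
  obtain ⟨u, hu, hle⟩ := exists_lt_le_localDegree (y := x + θ.1)
    ((WithBot.coe_lt_coe.2 (base_naturalSum_lt hb hθ.2.2.2)).trans_le h) (by linarith)
  exact ⟨u, hu.1, hu.2, hle⟩

theorem le_localDegree_of_eventually {f : HahnSeries ℝ K} {x : ℝ} {b : Ordinal}
    (h : ∀ᶠ θ in thresholds (lastExp b), (crossing f x b θ).Nonempty) : b ≤ localDegree f x := by
  by_contra hc
  obtain ⟨θ, ⟨u, h1, h2, h3⟩, hθ⟩ := (h.and (eventually_localDegree_lt_base (not_le.1 hc))).exists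
  exact (hθ u h1 h2).not_ge h3

theorem exists_isLeast_crossing {f : HahnSeries ℝ K} {x : ℝ} {b : Ordinal} {θ : ℝ × Ordinal}
    (h : (crossing f x b θ).Nonempty) : ∃ u, IsLeast (crossing f x b θ) u := by
  refine exists_isLeast_of_localDegree_ne_bot f h fun u hu hbot => ?_
  have := hu.2.2
  rw [hbot] at this
  simp at this

theorem coeff_ne_zero_of_localDegree_eq_zero {f : HahnSeries ℝ K} {x : ℝ}
    (h : localDegree f x = (0 : Ordinal)) : f.coeff x ≠ 0 := by
  intro hc
  obtain ⟨y, hy, hlt⟩ := localDegree_le_coe_iff.1 h.le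
  have hbot (u : ℝ) (hu : u ∈ Set.Ioo y x) : f.coeff u = 0 := by
    by_contra hcu
    obtain ⟨c, hc⟩ := WithBot.ne_bot_iff_exists.1 (localDegree_ne_bot_of_coeff hcu)
    have := hlt u hu
    rw [← hc, WithBot.coe_lt_coe] at this
    exact not_lt_zero this
  have : localDegree f x = ⊥ := localDegree_eq_bot_of_forall_le hy fun u hyu hux => by
    rcases hux.eq_or_lt with rfl | hux
    exacts [hc, hbot u ⟨hyu, hux⟩]
  rw [h] at this
  exact WithBot.coe_ne_bot this

end Crossing

theorem localDegree_add_of_lt {K : Type u} [AddCommGroup K] {f g : HahnSeries ℝ K} {x : ℝ}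
    (h : localDegree g x < localDegree f x) : localDegree (f + g) x = localDegree f x := by
  refine localDegree_eq_of_sub_lt ?_
  rwa [sub_add_cancel_left, localDegree_neg]

section Sign

variable {F : Type u} [Field F] [LinearOrder F]

/-- Positivity at `x` of a series that has local degree `b` at `x`. -/
def PosAux (f : HahnSeries ℝ F) (b : Ordinal.{0}) (x : ℝ) : Prop :=
  (b = 0 → 0 < f.coeff x) ∧ (b ≠ 0 → ∀ᶠ θ in thresholds (lastExp b),
    -- The bound `c < b` is there for the recursion to be well founded; it holds for almost all
    -- thresholds anyway, and `pos_iff` removes it.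
    ∃ u, IsLeast (crossing f x b θ) u ∧ ∃ c, ∃ _ : c < b, localDegree f u = c ∧ PosAux f c u)
termination_by b

/-- A series is positive at `x` if its coefficient at `x` is positive, when its local degree at `x`
is `0`, and otherwise if it is positive at the first points left of `x` whose local degrees reach
given thresholds, for almost all thresholds. -/
def Pos (f : HahnSeries ℝ F) (x : ℝ) : Prop :=
  ∃ b : Ordinal, localDegree f x = b ∧ PosAux f b x

theorem Pos.ne_bot {f : HahnSeries ℝ F} {x : ℝ} (h : Pos f x) : localDegree f x ≠ ⊥ := by
  obtain ⟨b, hb, -⟩ := h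
  exact hb ▸ WithBot.coe_ne_bot

theorem pos_iff_of_eq_zero {f : HahnSeries ℝ F} {x : ℝ}
    (h : localDegree f x = (0 : Ordinal)) : Pos f x ↔ 0 < f.coeff x := by
  constructor
  · rintro ⟨b, hb, hp⟩
    rw [h, WithBot.coe_inj] at hb
    rw [PosAux] at hp
    exact hp.1 hb.symm
  · intro hp
    refine ⟨0, h, ?_⟩
    rw [PosAux]
    exact ⟨fun _ => hp, fun h0 => absurd rfl h0⟩

theorem pos_iff {f : HahnSeries ℝ F} {x : ℝ} {b : Ordinal} (h : localDegree f x = b)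
    (hb : b ≠ 0) : Pos f x ↔ ∀ᶠ θ in thresholds (lastExp b),
      ∃ u, IsLeast (crossing f x b θ) u ∧ Pos f u := by
  constructor
  · rintro ⟨b', hb', hp⟩
    rw [h, WithBot.coe_inj] at hb'
    subst hb'
    rw [PosAux] at hp
    exact (hp.2 hb).mono fun θ ⟨u, hu, c, _, hc, hpc⟩ => ⟨u, hu, c, hc, hpc⟩
  · intro hp
    refine ⟨b, h, ?_⟩
    rw [PosAux]
    refine ⟨fun h0 => absurd h0 hb, fun _ => ?_⟩
    filter_upwards [hp, eventually_localDegree_lt h _] with θ ⟨u, hu, c, hc, hpc⟩ hlt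
    exact ⟨u, hu, c, WithBot.coe_lt_coe.1 (hc ▸ hlt u hu.1.1 hu.1.2.1), hc, hpc⟩

/-- For almost all thresholds the difference stays below the threshold near `x`. So both series have
the same crossings, and at the first one the difference is again of smaller local degree. -/
theorem Pos.congr {f g : HahnSeries ℝ F} {x : ℝ} (h : localDegree (f - g) x < localDegree f x)
    (hf : Pos f x) : Pos g x := by
  have key (b : Ordinal) : ∀ x, localDegree f x = b → localDegree (f - g) x < localDegree f x →
      Pos f x → Pos g x := by
    induction b using WellFoundedLT.induction with
    | ind b ih =>
      intro x hb h hf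
      have hg := (localDegree_eq_of_sub_lt h).trans hb
      by_cases hb0 : b = 0
      · subst hb0
        rw [pos_iff_of_eq_zero hb] at hf
        rw [pos_iff_of_eq_zero hg]
        have : (f - g).coeff x = 0 := by
          by_contra hc
          rw [hb] at h
          refine localDegree_ne_bot_of_coeff hc ?_
          cases hd : localDegree (f - g) x with
          | bot => rfl
          | coe d =>
            rw [hd] at h
            exact absurd (WithBot.coe_lt_coe.1 h) not_lt_zero
        rw [HahnSeries.coeff_sub, sub_eq_zero] at this
        rwa [← this]
      · rw [pos_iff hb hb0] at hf
        rw [pos_iff hg hb0]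
        filter_upwards [hf, eventually_localDegree_lt_base (hb ▸ h),
          eventually_localDegree_lt hb _] with θ ⟨u, hu, hpos⟩ hlt hltb
        have heq : crossing g x b θ = crossing f x b θ := by
          ext v
          refine and_congr_right fun h1 => and_congr_right fun h2 => ⟨fun h3 => ?_, fun h3 => ?_⟩
          · refine h3.trans_eq (localDegree_eq_of_sub_lt ?_).symm
            rw [← neg_sub, localDegree_neg]
            exact (hlt v h1 h2).trans_le h3
          · exact h3.trans_eq (localDegree_eq_of_sub_lt ((hlt v h1 h2).trans_le h3)).symm
        refine ⟨u, heq ▸ hu, ?_⟩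
        obtain ⟨c, hc⟩ := WithBot.ne_bot_iff_exists.1 hpos.ne_bot
        exact ih c (WithBot.coe_lt_coe.1 (hc ▸ hltb u hu.1.1 hu.1.2.1)) u hc.symm
          ((hlt u hu.1.1 hu.1.2.1).trans_le hu.1.2.2) hpos
  obtain ⟨b, hb, -⟩ := id hf
  exact key b x hb h hf

theorem Pos.add_of_lt {f g : HahnSeries ℝ F} {x : ℝ} (hf : Pos f x)
    (h : localDegree g x < localDegree f x) : Pos (f + g) x := by
  refine hf.congr ?_
  rwa [sub_add_cancel_left, localDegree_neg]

variable [IsStrictOrderedRing F]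

theorem pos_or_pos_neg {f : HahnSeries ℝ F} {x : ℝ} (h : localDegree f x ≠ ⊥) :
    Pos f x ∨ Pos (-f) x := by
  have key (b : Ordinal) : ∀ x, localDegree f x = b → Pos f x ∨ Pos (-f) x := by
    induction b using WellFoundedLT.induction with
    | ind b ih =>
      intro x hb
      have hb' : localDegree (-f) x = b := (localDegree_neg f x).trans hb
      by_cases hb0 : b = 0
      · subst hb0
        rw [pos_iff_of_eq_zero hb, pos_iff_of_eq_zero hb', HahnSeries.coeff_neg, neg_pos]
        exact (lt_or_gt_of_ne (coeff_ne_zero_of_localDegree_eq_zero hb)).symm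
      · rw [pos_iff hb hb0, pos_iff hb' hb0, ← eventually_thresholds_or]
        filter_upwards [eventually_crossing_nonempty hb0 hb.ge,
          eventually_localDegree_lt hb _] with θ hne hlt
        obtain ⟨u, hu⟩ := exists_isLeast_crossing hne
        have heq : crossing (-f) x b θ = crossing f x b θ := by
          simp only [crossing, localDegree_neg]
        have hbot : localDegree f u ≠ ⊥ := by
          intro hc
          have := hu.1.2.2
          rw [hc] at this
          simp at this
        obtain ⟨c, hc⟩ := WithBot.ne_bot_iff_exists.1 hbot
        rw [heq]
        exact (ih c (WithBot.coe_lt_coe.1 (hc ▸ hlt u hu.1.1 hu.1.2.1)) u hc.symm).imp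
          (fun h => ⟨u, hu, h⟩) fun h => ⟨u, hu, h⟩
  obtain ⟨b, hb⟩ := WithBot.ne_bot_iff_exists.1 h
  exact key b x hb.symm

/-- When the local degrees are equal, the first crossing of the sum is the earlier of the two first
crossings. There one series dominates, or both cross together and induction applies. -/
theorem Pos.localDegree_add_and_add {f g : HahnSeries ℝ F} {x : ℝ} (hf : Pos f x) (hg : Pos g x) :
    localDegree (f + g) x = max (localDegree f x) (localDegree g x) ∧ Pos (f + g) x := by
  have key (b : Ordinal) : ∀ x, localDegree f x = b → Pos f x → Pos g x →
      localDegree (f + g) x = max (localDegree f x) (localDegree g x) ∧ Pos (f + g) x := by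
    induction b using WellFoundedLT.induction with
    | ind b ih =>
      intro x hfb hf hg
      rcases lt_trichotomy (localDegree f x) (localDegree g x) with hlt | heq | hlt
      · rw [max_eq_right hlt.le, add_comm]
        exact ⟨localDegree_add_of_lt hlt, hg.add_of_lt hlt⟩
      swap
      · rw [max_eq_left hlt.le]
        exact ⟨localDegree_add_of_lt hlt, hf.add_of_lt hlt⟩
      have hgb : localDegree g x = b := heq ▸ hfb
      have hle : localDegree (f + g) x ≤ b := by
        have := localDegree_add_le f g x
        rwa [hfb, hgb, max_self] at this
      rw [heq, max_self, hgb]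
      by_cases hb0 : b = 0
      · subst hb0
        rw [pos_iff_of_eq_zero hfb] at hf
        rw [pos_iff_of_eq_zero hgb] at hg
        have hpos : 0 < (f + g).coeff x := add_pos hf hg
        have hd : localDegree (f + g) x = (0 : Ordinal) := by
          obtain ⟨c, hc⟩ := WithBot.ne_bot_iff_exists.1 (localDegree_ne_bot_of_coeff hpos.ne')
          rw [← hc, WithBot.coe_le_coe] at hle
          rw [← hc, le_antisymm hle zero_le]
        exact ⟨hd, (pos_iff_of_eq_zero hd).2 hpos⟩
      · rw [pos_iff hfb hb0] at hf
        rw [pos_iff hgb hb0] at hg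
        have hev : ∀ᶠ θ in thresholds (lastExp b),
            ∃ u, IsLeast (crossing (f + g) x b θ) u ∧ Pos (f + g) u := by
          filter_upwards [hf, hg, eventually_localDegree_lt hfb _] with θ ⟨u, hu, hpu⟩ ⟨w, hw, hpw⟩
            hltb
          have hsmall (v : ℝ) (hv : x + θ.1 < v) (hvu : v < u) (hvw : v < w) :
              localDegree (f + g) v < ((base b ♯ θ.2 : Ordinal) : WithBot Ordinal) := by
            refine (localDegree_add_le f g v).trans_lt (max_lt ?_ ?_)
            · by_contra hc
              exact (hu.2 ⟨hv, hvu.trans hu.1.2.1, not_lt.1 hc⟩).not_gt hvu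
            · by_contra hc
              exact (hw.2 ⟨hv, hvw.trans hw.1.2.1, not_lt.1 hc⟩).not_gt hvw
          have hleast (v : ℝ) (hv : v ∈ crossing (f + g) x b θ) : u ≤ v ∨ w ≤ v := by
            by_contra! hc
            exact (hsmall v hv.1 hc.1 hc.2).not_ge hv.2.2
          rcases lt_trichotomy u w with huw | rfl | hwu
          · have hlt : localDegree g u < localDegree f u := by
              refine lt_of_lt_of_le ?_ hu.1.2.2
              by_contra hc
              exact (hw.2 ⟨hu.1.1, hu.1.2.1, not_lt.1 hc⟩).not_gt huw
            exact ⟨u, ⟨⟨hu.1.1, hu.1.2.1, (localDegree_add_of_lt hlt).symm ▸ hu.1.2.2⟩,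
              fun v hv => (hleast v hv).elim id huw.le.trans⟩, hpu.add_of_lt hlt⟩
          · obtain ⟨c, hc⟩ := WithBot.ne_bot_iff_exists.1 hpu.ne_bot
            obtain ⟨h1, h2⟩ := ih c (WithBot.coe_lt_coe.1 (hc ▸ hltb u hu.1.1 hu.1.2.1)) u hc.symm
              hpu hpw
            exact ⟨u, ⟨⟨hu.1.1, hu.1.2.1, h1 ▸ hu.1.2.2.trans (le_max_left _ _)⟩,
              fun v hv => (hleast v hv).elim id id⟩, h2⟩
          · have hlt : localDegree f w < localDegree g w := by
              refine lt_of_lt_of_le ?_ hw.1.2.2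
              by_contra hc
              exact (hu.2 ⟨hw.1.1, hw.1.2.1, not_lt.1 hc⟩).not_gt hwu
            rw [add_comm f g] at hleast ⊢
            exact ⟨w, ⟨⟨hw.1.1, hw.1.2.1, (localDegree_add_of_lt hlt).symm ▸ hw.1.2.2⟩,
              fun v hv => (hleast v hv).elim hwu.le.trans id⟩, hpw.add_of_lt hlt⟩
        have hd := le_antisymm hle (le_localDegree_of_eventually
          (hev.mono fun θ ⟨u, hu, _⟩ => ⟨u, hu.1⟩))
        exact ⟨hd, (pos_iff hd hb0).2 hev⟩
  obtain ⟨b, hb, -⟩ := id hf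
  exact key b x hb hf hg

end Sign

/-! ### Products of positive series -/

section MulPos

variable {F : Type u} [Field F]

theorem localDegree_lt_of_sub_sub {p a b : HahnSeries ℝ F} {u : ℝ} {κ : WithBot Ordinal}
    (hr : localDegree (p - a - b) u < κ) (ha : localDegree a u < κ) (hb : localDegree b u < κ) :
    localDegree p u < κ := by
  have h : p = p - a - b + a + b := by abel
  rw [h]
  exact (localDegree_add_le _ _ _).trans_lt
    (max_lt ((localDegree_add_le _ _ _).trans_lt (max_lt hr ha)) hb)

theorem coeff_mul_add_of_support_subset {f g : HahnSeries ℝ F} {x y : ℝ}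
    (hf : f.support ⊆ Set.Iic x) (hg : g.support ⊆ Set.Iic y) :
    (f * g).coeff (x + y) = f.coeff x * g.coeff y := by
  rw [HahnSeries.coeff_mul, Finset.sum_eq_single (x, y)]
  · rintro ⟨p, q⟩ hpq hne
    rw [Finset.mem_antidiagonal] at hpq
    obtain ⟨hp, hq, h⟩ := hpq
    have hpx : p ≤ x := hf hp
    have hqy : q ≤ y := hg hq
    simp only at h
    exact absurd (Prod.ext (by simp only; linarith) (by simp only; linarith)) hne
  · intro hxy
    rw [Finset.mem_antidiagonal] at hxy
    by_contra hc
    exact hxy ⟨left_ne_zero_of_mul hc, right_ne_zero_of_mul hc, rfl⟩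

theorem TailLE.naturalSumBot_lt {b c : Ordinal.{0}} (h : TailLE b c) {b' c' : WithBot Ordinal.{0}}
    (hb : b' < b) (hc : c' < c) :
    b' ♯ᵇ c' < ((base b ♯ c : Ordinal.{0}) : WithBot Ordinal.{0}) := by
  cases b' with
  | bot => exact WithBot.bot_lt_coe _
  | coe b' =>
    cases c' with
    | bot => rw [naturalSumBot_bot]; exact WithBot.bot_lt_coe _
    | coe c' =>
      rw [coe_naturalSumBot_coe, WithBot.coe_lt_coe]
      exact h.naturalSum_lt (WithBot.coe_lt_coe.1 hb) (WithBot.coe_lt_coe.1 hc)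

/-- Near `x + y`, the product of `f` and `g` is a sum of the products of one series with a
truncation of the other, up to terms of small local degree. -/
theorem TailLE.eventually_localDegree_mul_sub_lt {f g : HahnSeries ℝ F} {x y : ℝ}
    {b c : Ordinal.{0}} (h : TailLE b c) (hfb : localDegree f x = b) (hgc : localDegree g y = c)
    (a : Ordinal) : ∀ᶠ θ in thresholds a, ∀ u, x + y + θ.1 < u → u < x + y →
      localDegree (f * g - restrict (Set.Iic (u - y)) f * g - f * restrict (Set.Iic (u - x)) g) u <
        ((base b ♯ c : Ordinal) : WithBot Ordinal) := by
  filter_upwards [eventually_localDegree_lt hfb a, eventually_localDegree_lt hgc a]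
    with θ hf hg u hu hux
  set f₁ := restrict (Set.Iic (u - y)) f with hf₁
  set f₂ := restrict (Set.Ioi (u - y)) f with hf₂
  set g₁ := restrict (Set.Iic (u - x)) g with hg₁
  set g₂ := restrict (Set.Ioi (u - x)) g with hg₂
  have hff : f = f₁ + f₂ := (restrict_Iic_add_restrict_Ioi f _).symm
  have hgg : g = g₁ + g₂ := (restrict_Iic_add_restrict_Ioi g _).symm
  -- The support of `f₁ * g₁` ends at `2 * u - x - y < u`. In `f₂ * g₂` only points strictly left of
  -- `x` and of `y` contribute at `u`, so both local degrees have dropped and `TailLE.naturalSum_lt`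
  -- applies.
  have heq : f * g - f₁ * g - f * g₁ = f₂ * g₂ - f₁ * g₁ := by
    rw [hff, hgg]
    ring
  rw [heq]
  refine (localDegree_sub_le _ _ _).trans_lt (max_lt (localDegree_mul_lt _ _ fun d => ?_) ?_)
  · rcases le_or_gt d (u - y) with hd | hd
    · rw [localDegree_restrict_Ioi_of_le f hd, bot_naturalSumBot]
      exact WithBot.bot_lt_coe _
    rcases le_or_gt x d with hd' | hd'
    · rw [localDegree_restrict_Ioi_of_le g (by linarith : u - d ≤ u - x), naturalSumBot_bot]
      exact WithBot.bot_lt_coe _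
    · exact h.naturalSumBot_lt
        ((localDegree_restrict_le _ _ _).trans_lt (hf d (by linarith) hd'))
        ((localDegree_restrict_le _ _ _).trans_lt (hg (u - d) (by linarith) (by linarith)))
  · have hs : (f₁ * g₁).support ⊆ Set.Iic (u - y + (u - x)) := by
      refine support_mul_subset_Iic ?_ ?_ <;> rw [support_restrict] <;>
        exact Set.inter_subset_left
    rw [localDegree_eq_bot_of_support_subset hs (by linarith)]
    exact WithBot.bot_lt_coe _

theorem localDegree_restrict_Iic_mul_le (f : HahnSeries ℝ F) {g : HahnSeries ℝ F} {y : ℝ}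
    (hg : g.support ⊆ Set.Iic y) (u : ℝ) :
    localDegree (restrict (Set.Iic (u - y)) f * g) u ≤
      localDegree f (u - y) ♯ᵇ localDegree g y := by
  have := localDegree_mul_le_of_support_subset (f := restrict (Set.Iic (u - y)) f) (x := u - y)
    (by rw [support_restrict]; exact Set.inter_subset_left) hg
  rwa [localDegree_restrict_Iic_of_le f le_rfl, sub_add_cancel] at this

variable [LinearOrder F]

theorem Pos.restrict_Iic {f : HahnSeries ℝ F} {x : ℝ} (h : Pos f x) :
    Pos (restrict (Set.Iic x) f) x := by
  refine h.congr ?_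
  rw [sub_eq_of_eq_add' (restrict_Iic_add_restrict_Ioi f x).symm,
    localDegree_restrict_Ioi_of_le f le_rfl]
  exact bot_lt_iff_ne_bot.2 h.ne_bot

variable [IsStrictOrderedRing F]

/-- Below, `p` is the product, `a` and `b` are the two products with a truncation, and `κ` is the
threshold at a first crossing. -/
theorem Pos.of_sub_sub {p a b : HahnSeries ℝ F} {u : ℝ} {κ : WithBot Ordinal}
    (hr : localDegree (p - a - b) u < κ)
    (ha : localDegree a u < κ ∨ κ ≤ localDegree a u ∧ Pos a u)
    (hb : localDegree b u < κ ∨ κ ≤ localDegree b u ∧ Pos b u)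
    (hab : ¬(localDegree a u < κ ∧ localDegree b u < κ)) :
    κ ≤ localDegree p u ∧ Pos p u := by
  have hsum : κ ≤ localDegree (a + b) u ∧ Pos (a + b) u := by
    rcases ha with ha | ⟨ha, hpa⟩ <;> rcases hb with hb | ⟨hb, hpb⟩
    · exact absurd ⟨ha, hb⟩ hab
    · rw [add_comm, localDegree_add_of_lt (ha.trans_le hb)]
      exact ⟨hb, hpb.add_of_lt (ha.trans_le hb)⟩
    · rw [localDegree_add_of_lt (hb.trans_le ha)]
      exact ⟨ha, hpa.add_of_lt (hb.trans_le ha)⟩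
    · obtain ⟨h1, h2⟩ := hpa.localDegree_add_and_add hpb
      exact ⟨h1 ▸ ha.trans (le_max_left _ _), h2⟩
  have hlt : localDegree (a + b - p) u < localDegree (a + b) u := by
    have h : a + b - p = -(p - a - b) := by abel
    rw [h, localDegree_neg]
    exact hr.trans_le hsum.1
  exact ⟨(localDegree_eq_of_sub_lt hlt).symm ▸ hsum.1, hsum.2.congr hlt⟩

/-- The induction step for `Pos.localDegree_mul_and_mul`. -/
theorem TailLE.localDegree_mul_and_mul {f g : HahnSeries ℝ F} {x y : ℝ}
    (hf : f.support ⊆ Set.Iic x) (hg : g.support ⊆ Set.Iic y) {b c : Ordinal.{0}}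
    (hfb : localDegree f x = b) (hgc : localDegree g y = c) (hpf : Pos f x) (hpg : Pos g y)
    (h : TailLE b c)
    (ihf : ∀ u, localDegree f u < b → Pos f u →
      localDegree (restrict (Set.Iic u) f * g) (u + y) = localDegree f u ♯ᵇ c ∧
        Pos (restrict (Set.Iic u) f * g) (u + y))
    (ihg : ∀ u, localDegree g u < c → Pos g u →
      localDegree (f * restrict (Set.Iic u) g) (x + u) = b ♯ᵇ localDegree g u ∧
        Pos (f * restrict (Set.Iic u) g) (x + u)) :
    localDegree (f * g) (x + y) = ((b ♯ c : Ordinal) : WithBot Ordinal) ∧ Pos (f * g) (x + y) := by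
  -- The last term of `b ♯ c` can be taken from `b`, so thresholds for the product are those for `f`
  -- shifted by `c`, along the same ultrafilter.
  obtain ⟨hbase, hlast⟩ := h.isTail_naturalSum.unique
  have hle : localDegree (f * g) (x + y) ≤ ((b ♯ c : Ordinal) : WithBot Ordinal) := by
    have := localDegree_mul_le_of_support_subset hf hg
    rwa [hfb, hgc] at this
  rw [pos_iff hfb h.1] at hpf
  have hA (r : Ordinal.{0}) (u : ℝ)
      (hu : localDegree f (u - y) < ((base b ♯ r : Ordinal) : WithBot Ordinal)) :
      localDegree (restrict (Set.Iic (u - y)) f * g) u <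
        ((base b ♯ c ♯ r : Ordinal) : WithBot Ordinal) := by
    refine (localDegree_restrict_Iic_mul_le f hg u).trans_lt ?_
    have := naturalSumBot_lt_naturalSumBot_of_lt_of_le hu (le_refl (c : WithBot Ordinal))
      WithBot.coe_ne_bot
    rw [hgc]
    refine this.trans_eq ?_
    rw [coe_naturalSumBot_coe]
    congr 1
    ac_rfl
  have hB (u : ℝ) : localDegree (f * restrict (Set.Iic (u - x)) g) u ≤
      b ♯ᵇ localDegree g (u - x) := by
    rw [mul_comm, naturalSumBot_comm, ← hfb]
    exact localDegree_restrict_Iic_mul_le g hf u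
  have hApos (r : Ordinal.{0}) (u : ℝ) (hlt : localDegree f u < b)
      (hu : ((base b ♯ r : Ordinal) : WithBot Ordinal) ≤ localDegree f u) (hp : Pos f u) :
      ((base b ♯ c ♯ r : Ordinal) : WithBot Ordinal) ≤
          localDegree (restrict (Set.Iic (u + y - y)) f * g) (u + y) ∧
        Pos (restrict (Set.Iic (u + y - y)) f * g) (u + y) := by
    rw [add_sub_cancel_right]
    obtain ⟨h1, h2⟩ := ihf u hlt hp
    refine ⟨?_, h2⟩
    rw [h1]
    refine le_trans (le_of_eq ?_) (naturalSumBot_le_naturalSumBot hu le_rfl)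
    rw [coe_naturalSumBot_coe]
    congr 1
    ac_rfl
  have hκ (r : Ordinal.{0}) : ((base b ♯ c : Ordinal) : WithBot Ordinal) ≤
      ((base b ♯ c ♯ r : Ordinal) : WithBot Ordinal) := by
    rw [WithBot.coe_le_coe]
    conv_lhs => rw [← naturalSum_zero (base b ♯ c)]
    exact naturalSum_le_naturalSum le_rfl zero_le
  have hev : ∀ᶠ θ in thresholds (lastExp (b ♯ c)),
      ∃ u, IsLeast (crossing (f * g) (x + y) (b ♯ c) θ) u ∧ Pos (f * g) u := by
    rw [hlast]
    -- With equal last exponents both factors contribute: `base b ♯ c = b ♯ base c`, and the first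
    -- crossing of the product is the earlier of `u + y` and `w + x`. Otherwise `f` times a
    -- truncation of `g` stays below every threshold, and the first crossing is `u + y`.
    by_cases hcase : c ≠ 0 ∧ lastExp b = lastExp c
    · obtain ⟨hc0, hbc⟩ := hcase
      rw [pos_iff hgc hc0, ← hbc] at hpg
      filter_upwards [hpf, hpg, h.eventually_localDegree_mul_sub_lt hfb hgc (lastExp b),
        eventually_localDegree_lt hfb _, eventually_localDegree_lt hgc _]
        with θ ⟨u, hu, hpu⟩ ⟨w, hw, hpw⟩ hr hltf hltg
      have hswap : base b ♯ c = b ♯ base c := by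
        conv_lhs => rw [(isTail_base hc0).1]
        conv_rhs => rw [(isTail_base h.1).1, hbc]
        ac_rfl
      have hAs (v : ℝ) (hv : x + y + θ.1 < v) (hvu : v < u + y) :
          localDegree (restrict (Set.Iic (v - y)) f * g) v <
            ((base b ♯ c ♯ θ.2 : Ordinal) : WithBot Ordinal) := by
        refine hA θ.2 v ?_
        by_contra hc
        have := hu.2 (⟨by linarith, by linarith [hu.1.2.1], not_lt.1 hc⟩ :
          v - y ∈ crossing f x b θ)
        linarith
      have hBs (v : ℝ) (hv : x + y + θ.1 < v) (hvw : v < w + x) :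
          localDegree (f * restrict (Set.Iic (v - x)) g) v <
            ((base b ♯ c ♯ θ.2 : Ordinal) : WithBot Ordinal) := by
        refine (hB v).trans_lt ?_
        have hlt : localDegree g (v - x) < ((base c ♯ θ.2 : Ordinal) : WithBot Ordinal) := by
          by_contra hc
          have := hw.2 (⟨by linarith, by linarith [hw.1.2.1], not_lt.1 hc⟩ :
            v - x ∈ crossing g y c θ)
          linarith
        refine (naturalSumBot_lt_naturalSumBot_of_le_of_lt (le_refl (b : WithBot Ordinal)) hlt
          WithBot.coe_ne_bot).trans_eq ?_
        rw [coe_naturalSumBot_coe, hswap]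
        congr 1
        ac_rfl
      have hBpos : ((base b ♯ c ♯ θ.2 : Ordinal) : WithBot Ordinal) ≤
            localDegree (f * restrict (Set.Iic (w + x - x)) g) (w + x) ∧
          Pos (f * restrict (Set.Iic (w + x - x)) g) (w + x) := by
        rw [add_sub_cancel_right]
        obtain ⟨h1, h2⟩ := ihg w (hltg w hw.1.1 hw.1.2.1) hpw
        rw [add_comm w x]
        refine ⟨?_, h2⟩
        rw [h1]
        refine le_trans (le_of_eq ?_) (naturalSumBot_le_naturalSumBot le_rfl hw.1.2.2)
        rw [coe_naturalSumBot_coe, hswap]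
        congr 1
        ac_rfl
      have hApos' := hApos θ.2 u (hltf u hu.1.1 hu.1.2.1) hu.1.2.2 hpu
      have hm1 : min (u + y) (w + x) < x + y :=
        (min_le_left _ _).trans_lt (by linarith [hu.1.2.1])
      have hm2 : x + y + θ.1 < min (u + y) (w + x) :=
        lt_min (by linarith [hu.1.1]) (by linarith [hw.1.1])
      have hmain := Pos.of_sub_sub ((hr _ hm2 hm1).trans_le (hκ θ.2))
        (by
          rcases (min_le_left (u + y) (w + x)).eq_or_lt with heq | hlt
          · rw [heq]; exact Or.inr hApos'
          · exact Or.inl (hAs _ hm2 hlt))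
        (by
          rcases (min_le_right (u + y) (w + x)).eq_or_lt with heq | hlt
          · rw [heq]; exact Or.inr hBpos
          · exact Or.inl (hBs _ hm2 hlt))
        (by
          rintro ⟨h1, h2⟩
          rcases min_choice (u + y) (w + x) with heq | heq
          · rw [heq] at h1
            exact h1.not_ge hApos'.1
          · rw [heq] at h2
            exact h2.not_ge hBpos.1)
      refine ⟨min (u + y) (w + x), ⟨⟨hm2, hm1, hbase.symm ▸ hmain.1⟩, fun v hv => ?_⟩, hmain.2⟩
      by_contra hc
      obtain ⟨hv1, hv2⟩ := lt_min_iff.1 (not_le.1 hc)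
      have hv3 := hv.2.2
      rw [hbase] at hv3
      exact hv3.not_gt (localDegree_lt_of_sub_sub ((hr v hv.1 hv.2.1).trans_le (hκ θ.2))
        (hAs v hv.1 hv1) (hBs v hv.1 hv2))
    · filter_upwards [hpf, h.eventually_localDegree_mul_sub_lt hfb hgc (lastExp b),
        eventually_localDegree_lt hfb _, eventually_localDegree_lt hgc _]
        with θ ⟨u, hu, hpu⟩ hr hltf hltg
      have hBs (v : ℝ) (hv : x + y + θ.1 < v) (hvxy : v < x + y) :
          localDegree (f * restrict (Set.Iic (v - x)) g) v <
            ((base b ♯ c ♯ θ.2 : Ordinal) : WithBot Ordinal) := by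
        refine (hB v).trans_lt (lt_of_lt_of_le ?_ (hκ θ.2))
        have hlt := hltg (v - x) (by linarith) (by linarith)
        cases hd : localDegree g (v - x) with
        | bot => rw [naturalSumBot_bot]; exact WithBot.bot_lt_coe _
        | coe d =>
          rw [hd, WithBot.coe_lt_coe] at hlt
          rw [coe_naturalSumBot_coe, WithBot.coe_lt_coe]
          exact h.naturalSum_lt_of_lt (fun he => hcase ⟨ne_bot_of_gt hlt, he⟩) hlt
      have hApos' := hApos θ.2 u (hltf u hu.1.1 hu.1.2.1) hu.1.2.2 hpu
      have hm1 : u + y < x + y := by linarith [hu.1.2.1]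
      have hm2 : x + y + θ.1 < u + y := by linarith [hu.1.1]
      have hmain := Pos.of_sub_sub ((hr _ hm2 hm1).trans_le (hκ θ.2)) (Or.inr hApos')
        (Or.inl (hBs _ hm2 hm1)) (fun h => h.1.not_ge hApos'.1)
      refine ⟨u + y, ⟨⟨hm2, hm1, hbase.symm ▸ hmain.1⟩, fun v hv => ?_⟩, hmain.2⟩
      have hv3 := hv.2.2
      rw [hbase] at hv3
      by_contra hc
      refine hv3.not_gt (localDegree_lt_of_sub_sub ((hr v hv.1 hv.2.1).trans_le (hκ θ.2))
        (hA θ.2 v ?_) (hBs v hv.1 hv.2.1))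
      by_contra hc'
      have := hu.2 (⟨by linarith [hv.1], by linarith [hv.2.1], not_lt.1 hc'⟩ :
        v - y ∈ crossing f x b θ)
      linarith
  have hd := le_antisymm hle (le_localDegree_of_eventually
    (hev.mono fun θ ⟨u, hu, _⟩ => ⟨u, hu.1⟩))
  exact ⟨hd, (pos_iff hd h.isTail_naturalSum.ne_zero).2 hev⟩

/-- Induction on the natural sum of the two local degrees. Truncating a factor at an earlier point
of smaller local degree lowers this sum and keeps the point at the top of the support; by symmetry
`TailLE b c` may be assumed. -/
theorem Pos.localDegree_mul_and_mul {f g : HahnSeries ℝ F} {x y : ℝ}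
    (hf : f.support ⊆ Set.Iic x) (hg : g.support ⊆ Set.Iic y) (hpf : Pos f x) (hpg : Pos g y) :
    localDegree (f * g) (x + y) = localDegree f x ♯ᵇ localDegree g y ∧ Pos (f * g) (x + y) := by
  have key (s : Ordinal.{0}) : ∀ (f g : HahnSeries ℝ F) (x y : ℝ) (b c : Ordinal.{0}),
      b ♯ c = s → f.support ⊆ Set.Iic x → g.support ⊆ Set.Iic y → localDegree f x = b →
      localDegree g y = c → Pos f x → Pos g y →
      localDegree (f * g) (x + y) = ((b ♯ c : Ordinal) : WithBot Ordinal) ∧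
        Pos (f * g) (x + y) := by
    induction s using WellFoundedLT.induction with
    | ind s ih =>
      intro f g x y b c hs hf hg hfb hgc hpf hpg
      have hsupp (f : HahnSeries ℝ F) (u : ℝ) : (restrict (Set.Iic u) f).support ⊆ Set.Iic u := by
        rw [support_restrict]
        exact Set.inter_subset_left
      have ihf (u : ℝ) (hu : localDegree f u < b) (hp : Pos f u) :
          localDegree (restrict (Set.Iic u) f * g) (u + y) = localDegree f u ♯ᵇ c ∧
            Pos (restrict (Set.Iic u) f * g) (u + y) := by
        obtain ⟨b', hb'⟩ := WithBot.ne_bot_iff_exists.1 hp.ne_bot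
        rw [← hb', WithBot.coe_lt_coe] at hu
        rw [← hb']
        exact ih _ (hs ▸ naturalSum_lt_naturalSum_left c hu) _ g u y b' c rfl (hsupp f u) hg
          ((localDegree_restrict_Iic_of_le f le_rfl).trans hb'.symm) hgc hp.restrict_Iic hpg
      have ihg (u : ℝ) (hu : localDegree g u < c) (hp : Pos g u) :
          localDegree (f * restrict (Set.Iic u) g) (x + u) = b ♯ᵇ localDegree g u ∧
            Pos (f * restrict (Set.Iic u) g) (x + u) := by
        obtain ⟨c', hc'⟩ := WithBot.ne_bot_iff_exists.1 hp.ne_bot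
        rw [← hc', WithBot.coe_lt_coe] at hu
        rw [← hc']
        exact ih _ (hs ▸ naturalSum_lt_naturalSum_right b hu) f _ x u b c' rfl hf (hsupp g u) hfb
          ((localDegree_restrict_Iic_of_le g le_rfl).trans hc'.symm) hpf hp.restrict_Iic
      by_cases hbc : b ≠ 0 ∨ c ≠ 0
      · rcases tailLE_total hbc with h | h
        · exact h.localDegree_mul_and_mul hf hg hfb hgc hpf hpg ihf ihg
        · rw [mul_comm, add_comm, naturalSum_comm]
          refine h.localDegree_mul_and_mul hg hf hgc hfb hpg hpf (fun u hu hp => ?_)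
            fun u hu hp => ?_
          · rw [mul_comm, add_comm, naturalSumBot_comm]
            exact ihg u hu hp
          · rw [mul_comm, add_comm, naturalSumBot_comm]
            exact ihf u hu hp
      · push Not at hbc
        obtain ⟨rfl, rfl⟩ := hbc
        rw [pos_iff_of_eq_zero hfb] at hpf
        rw [pos_iff_of_eq_zero hgc] at hpg
        have hpos : 0 < (f * g).coeff (x + y) := by
          rw [coeff_mul_add_of_support_subset hf hg]
          exact mul_pos hpf hpg
        have hle := localDegree_mul_le_of_support_subset hf hg
        rw [hfb, hgc, coe_naturalSumBot_coe, naturalSum_zero] at hle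
        rw [naturalSum_zero]
        obtain ⟨d, hd⟩ := WithBot.ne_bot_iff_exists.1 (localDegree_ne_bot_of_coeff hpos.ne')
        rw [← hd, WithBot.coe_le_coe] at hle
        have hd0 : localDegree (f * g) (x + y) = (0 : Ordinal) := by
          rw [← hd, le_antisymm hle zero_le]
        exact ⟨hd0, (pos_iff_of_eq_zero hd0).2 hpos⟩
  obtain ⟨b, hb⟩ := WithBot.ne_bot_iff_exists.1 hpf.ne_bot
  obtain ⟨c, hc⟩ := WithBot.ne_bot_iff_exists.1 hpg.ne_bot
  rw [← hb, ← hc]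
  exact key _ f g x y b c rfl hf hg hb.symm hc.symm hpf hpg

/-- Over an ordered field, the local degree is multiplicative. -/
theorem localDegree_mul_of_ordered {f g : HahnSeries ℝ F} {x y : ℝ}
    (hf : f.support ⊆ Set.Iic x) (hg : g.support ⊆ Set.Iic y) :
    localDegree (f * g) (x + y) = localDegree f x ♯ᵇ localDegree g y := by
  by_cases hfx : localDegree f x = ⊥
  · have := localDegree_mul_le_of_support_subset hf hg
    rw [hfx, bot_naturalSumBot] at this ⊢
    exact le_bot_iff.1 this
  by_cases hgy : localDegree g y = ⊥
  · have := localDegree_mul_le_of_support_subset hf hg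
    rw [hgy, naturalSumBot_bot] at this ⊢
    exact le_bot_iff.1 this
  have hf' : (-f).support ⊆ Set.Iic x := by rwa [HahnSeries.support_neg]
  have hg' : (-g).support ⊆ Set.Iic y := by rwa [HahnSeries.support_neg]
  rcases pos_or_pos_neg hfx with h | h <;> rcases pos_or_pos_neg hgy with h' | h'
  · exact (h.localDegree_mul_and_mul hf hg h').1
  · have := (h.localDegree_mul_and_mul hf hg' h').1
    rwa [mul_neg, localDegree_neg, localDegree_neg] at this
  · have := (h.localDegree_mul_and_mul hf' hg h').1
    rwa [neg_mul, localDegree_neg, localDegree_neg] at this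
  · have := (h.localDegree_mul_and_mul hf' hg' h').1
    rwa [neg_mul_neg, localDegree_neg, localDegree_neg] at this

/-- Over an ordered field, squares of series do not cancel. -/
theorem localDegree_mul_self_add_mul_self {f g : HahnSeries ℝ F} {x : ℝ}
    (hf : f.support ⊆ Set.Iic x) (hg : g.support ⊆ Set.Iic x) :
    localDegree (f * f + g * g) (x + x) = max (localDegree f x) (localDegree g x) ♯ᵇ
      max (localDegree f x) (localDegree g x) := by
  have hsq {f : HahnSeries ℝ F} (hf : f.support ⊆ Set.Iic x) (hfx : localDegree f x ≠ ⊥) :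
      Pos (f * f) (x + x) := by
    rcases pos_or_pos_neg hfx with h | h
    · exact (h.localDegree_mul_and_mul hf hf h).2
    · have hf' : (-f).support ⊆ Set.Iic x := by rwa [HahnSeries.support_neg]
      rw [← neg_mul_neg]
      exact (h.localDegree_mul_and_mul hf' hf' h).2
  have hff := localDegree_mul_of_ordered hf hf
  have hgg := localDegree_mul_of_ordered hg hg
  rcases lt_trichotomy (localDegree f x) (localDegree g x) with h | h | h
  · rw [max_eq_right h.le, add_comm, localDegree_add_of_lt, hgg]
    rw [hff, hgg]
    exact naturalSumBot_lt_naturalSumBot_of_lt_of_le h h.le (ne_bot_of_gt h)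
  · rw [h, max_self, ← hgg]
    by_cases hb : localDegree g x = ⊥
    · have := localDegree_add_le (f * f) (g * g) (x + x)
      rw [hff, hgg, h, hb, naturalSumBot_bot, max_self] at this
      rw [hgg, hb, naturalSumBot_bot]
      exact le_bot_iff.1 this
    · rw [((hsq hf (h ▸ hb)).localDegree_add_and_add (hsq hg hb)).1, hff, hgg, h, max_self]
  · rw [max_eq_left h.le, localDegree_add_of_lt, hff]
    rw [hff, hgg]
    exact naturalSumBot_lt_naturalSumBot_of_lt_of_le h h.le (ne_bot_of_gt h)

end MulPos

/-! ### Multiplicativity of the local degree over fields of characteristic zero -/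

theorem support_map_of_injective {R : Type u} {S : Type v} [Zero R] [Zero S] {G : Type*}
    [FunLike G R S] [ZeroHomClass G R S] {φ : G} (hφ : Function.Injective φ)
    (f : HahnSeries ℝ R) : (f.map φ).support = f.support := by
  ext x
  simp only [HahnSeries.mem_support, HahnSeries.map_coeff, ne_eq, map_eq_zero_iff φ hφ]

theorem localDegree_map_of_injective {R : Type u} {S : Type v} [Zero R] [Zero S] {G : Type*}
    [FunLike G R S] [ZeroHomClass G R S] {φ : G} (hφ : Function.Injective φ)
    (f : HahnSeries ℝ R) (x : ℝ) : localDegree (f.map φ) x = localDegree f x :=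
  le_antisymm (localDegree_mono (support_map_of_injective hφ f).subset x)
    (localDegree_mono (support_map_of_injective hφ f).superset x)

theorem map_ringHom_mul {R : Type u} {S : Type v} [Ring R] [Ring S] (φ : R →+* S)
    (f g : HahnSeries ℝ R) : (f * g).map φ = f.map φ * g.map φ :=
  HahnSeries.map_mul (φ : R →ₙ+* S)

theorem support_subset_of_coeff {R : Type u} {S : Type v} [Zero R] [Zero S] {f : HahnSeries ℝ R}
    {g : HahnSeries ℝ S} {s : Set ℝ} (hg : g.support ⊆ s)
    (h : ∀ x, g.coeff x = 0 → f.coeff x = 0) : f.support ⊆ s :=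
  fun x hx => hg fun hc => hx (h x hc)

/-! ### Complex series, through real and imaginary parts -/

section Complex

/-- The real part of a complex series. -/
def rePart (f : HahnSeries ℝ ℂ) : HahnSeries ℝ ℝ := f.map Complex.reLm

/-- The imaginary part of a complex series. -/
def imPart (f : HahnSeries ℝ ℂ) : HahnSeries ℝ ℝ := f.map Complex.imLm

theorem eq_rePart_add_imPart (f : HahnSeries ℝ ℂ) :
    f = (rePart f).map Complex.ofRealHom + Complex.I • (imPart f).map Complex.ofRealHom := by
  ext x
  simp [rePart, imPart, mul_comm Complex.I, Complex.re_add_im]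

theorem map_conj_eq (f : HahnSeries ℝ ℂ) :
    f.map (starRingEnd ℂ) =
      (rePart f).map Complex.ofRealHom - Complex.I • (imPart f).map Complex.ofRealHom := by
  ext x
  apply Complex.ext <;> simp [rePart, imPart]

theorem mul_map_conj (f : HahnSeries ℝ ℂ) : f * f.map (starRingEnd ℂ) =
    (rePart f * rePart f + imPart f * imPart f).map Complex.ofRealHom := by
  have hadd : (rePart f * rePart f + imPart f * imPart f).map Complex.ofRealHom =
      (rePart f * rePart f).map Complex.ofRealHom + (imPart f * imPart f).map Complex.ofRealHom := by
    ext x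
    simp
  rw [map_conj_eq, hadd, map_ringHom_mul, map_ringHom_mul]
  conv_lhs => enter [1]; rw [eq_rePart_add_imPart f]
  generalize (rePart f).map Complex.ofRealHom = a
  generalize (imPart f).map Complex.ofRealHom = b
  have hI : (Complex.I • b) * (Complex.I • b) = -(b * b) := by
    rw [← HahnSeries.C_mul_eq_smul, mul_mul_mul_comm, ← map_mul, Complex.I_mul_I, map_neg,
      map_one, neg_one_mul]
  calc (a + Complex.I • b) * (a - Complex.I • b) =
      a * a - (Complex.I • b) * (Complex.I • b) := by ring
    _ = _ := by rw [hI, sub_neg_eq_add]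

theorem localDegree_eq_max (f : HahnSeries ℝ ℂ) (x : ℝ) :
    localDegree f x = max (localDegree (rePart f) x) (localDegree (imPart f) x) := by
  refine le_antisymm ?_ (max_le (localDegree_mono ?_ x) (localDegree_mono ?_ x))
  · conv_lhs => rw [eq_rePart_add_imPart f]
    refine (localDegree_add_le _ _ _).trans (max_le_max ?_ ?_)
    · exact (localDegree_map_of_injective Complex.ofRealHom.injective _ _).le
    · rw [← localDegree_map_of_injective (φ := Complex.ofRealHom) Complex.ofRealHom.injective]
      refine localDegree_mono (support_subset_of_coeff subset_rfl fun x hx => ?_) x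
      rw [HahnSeries.coeff_smul, hx, smul_zero]
  · exact support_subset_of_coeff subset_rfl fun x hx => by simp [rePart, hx]
  · exact support_subset_of_coeff subset_rfl fun x hx => by simp [imPart, hx]

theorem localDegree_mul_map_conj {f : HahnSeries ℝ ℂ} {x : ℝ} (hf : f.support ⊆ Set.Iic x) :
    localDegree (f * f.map (starRingEnd ℂ)) (x + x) = localDegree f x ♯ᵇ localDegree f x := by
  rw [mul_map_conj, localDegree_map_of_injective Complex.ofRealHom.injective,
    localDegree_mul_self_add_mul_self, localDegree_eq_max f x]
  · exact support_subset_of_coeff hf fun x hx => by simp [rePart, hx]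
  · exact support_subset_of_coeff hf fun x hx => by simp [imPart, hx]

/-- The product of `f * g` with its conjugate is also the product of two real series, the squared
norms of `f` and `g`. The real case thus gives the identity with both sides doubled. -/
theorem localDegree_mul_of_complex {f g : HahnSeries ℝ ℂ} {x y : ℝ}
    (hf : f.support ⊆ Set.Iic x) (hg : g.support ⊆ Set.Iic y) :
    localDegree (f * g) (x + y) = localDegree f x ♯ᵇ localDegree g y := by
  apply naturalSumBot_self_injective
  have hre {f : HahnSeries ℝ ℂ} {x : ℝ} (hf : f.support ⊆ Set.Iic x) :
      (rePart f * rePart f + imPart f * imPart f).support ⊆ Set.Iic (x + x) := by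
    refine (HahnSeries.support_add_subset _ _).trans (Set.union_subset ?_ ?_)
    · have : (rePart f).support ⊆ Set.Iic x :=
        support_subset_of_coeff hf fun x hx => by simp [rePart, hx]
      exact support_mul_subset_Iic this this
    · have : (imPart f).support ⊆ Set.Iic x :=
        support_subset_of_coeff hf fun x hx => by simp [imPart, hx]
      exact support_mul_subset_Iic this this
  rw [← localDegree_mul_map_conj (support_mul_subset_Iic hf hg), map_ringHom_mul,
    mul_mul_mul_comm, add_add_add_comm, mul_map_conj, mul_map_conj, ← map_ringHom_mul,
    localDegree_map_of_injective Complex.ofRealHom.injective,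
    localDegree_mul_of_ordered (hre hf) (hre hg),
    ← localDegree_map_of_injective Complex.ofRealHom.injective, ← mul_map_conj,
    localDegree_mul_map_conj hf,
    ← localDegree_map_of_injective (φ := Complex.ofRealHom) Complex.ofRealHom.injective,
    ← mul_map_conj, localDegree_mul_map_conj hg]
  ac_rfl

end Complex

/-! ### Reduction from characteristic zero to the complex numbers -/

theorem exists_ringHom_complex (K : Type u) [Field K] [CharZero K] [Countable K] :
    Nonempty (K →+* ℂ) := by
  -- Continuum many variables make the cardinality of `L` exactly that of `ℂ`; uncountable
  -- algebraically closed fields of characteristic `0` and equal cardinality are isomorphic.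
  let A := MvPolynomial ℝ K
  let L := AlgebraicClosure (FractionRing A)
  have : CharZero (FractionRing A) :=
    charZero_of_injective_algebraMap (IsFractionRing.injective A (FractionRing A))
  have hinj : Function.Injective (algebraMap A L) := by
    rw [IsScalarTower.algebraMap_eq A (FractionRing A) L]
    exact (algebraMap (FractionRing A) L).injective.comp
      (IsFractionRing.injective A (FractionRing A))
  have hcont : Cardinal.lift.{u} (Cardinal.mk ℝ) = Cardinal.continuum := by
    rw [Cardinal.mk_real, Cardinal.lift_continuum]
  have hle : Cardinal.mk L ≤ Cardinal.continuum := by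
    have h1 : Cardinal.mk L ≤ max (Cardinal.mk (FractionRing A)) Cardinal.aleph0 :=
      Algebra.IsAlgebraic.cardinalMk_le_max _ _
    rw [Cardinal.mk_fractionRing] at h1
    refine h1.trans (max_le (MvPolynomial.cardinalMk_le_max_lift.trans ?_)
      Cardinal.aleph0_le_continuum)
    rw [hcont, Cardinal.lift_id']
    exact max_le (max_le ((Cardinal.mk_le_aleph0).trans Cardinal.aleph0_le_continuum) le_rfl)
      Cardinal.aleph0_le_continuum
  have hge : Cardinal.continuum ≤ Cardinal.mk L := by
    have := Cardinal.mk_le_of_injective (α := ULift.{u} ℝ)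
      (f := fun r => algebraMap A L (MvPolynomial.X r.down)) fun r s h =>
        ULift.ext _ _ (MvPolynomial.X_injective (hinj h))
    rwa [Cardinal.mk_uLift, hcont] at this
  have heq := le_antisymm hle hge
  have hequiv : Nonempty (L ≃ ℂ) := by
    rw [← Cardinal.lift_mk_eq', heq, Cardinal.mk_complex, Cardinal.lift_continuum,
      Cardinal.lift_continuum]
  obtain ⟨e⟩ := IsAlgClosed.ringEquiv_of_equiv_of_charZero
    (heq ▸ Cardinal.aleph0_lt_continuum) hequiv
  exact ⟨(e : L →+* ℂ).comp ((algebraMap A L).comp MvPolynomial.C)⟩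

/-- By the gaps, every exponent is isolated on its right within the support, and a set of reals has
only countably many such points. -/
theorem countable_support {R : Type u} [Zero R] (f : HahnSeries ℝ R) : f.support.Countable := by
  refine Set.Countable.mono (fun x hx => ?_)
    (countable_setOfPred_isolated_right_within (s := f.support))
  refine ⟨hx, ?_⟩
  obtain ⟨w, hw, h⟩ := exists_gap f x
  rw [← Filter.empty_mem_iff_bot, mem_nhdsWithin]
  refine ⟨Set.Iio w, isOpen_Iio, hw, fun u hu => ?_⟩
  exact hu.2.1 (h u ⟨hu.2.2, le_of_lt hu.1⟩)

theorem countable_range_coeff {R : Type u} [Zero R] (f : HahnSeries ℝ R) :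
    (Set.range f.coeff).Countable := by
  refine (((countable_support f).image f.coeff).insert 0).mono ?_
  rintro _ ⟨x, rfl⟩
  by_cases h : f.coeff x = 0
  · exact Or.inl h
  · exact Or.inr ⟨x, h, rfl⟩

theorem exists_map_subtype_eq {K : Type u} [Field K] (S : Subfield K) (f : HahnSeries ℝ K)
    (h : Set.range f.coeff ⊆ S) : ∃ f' : HahnSeries ℝ S, f'.map S.subtype = f :=
  ⟨{ coeff := fun x => ⟨f.coeff x, h ⟨x, rfl⟩⟩
     isPWO_support' := f.isPWO_support.mono fun _ hx hc => hx (Subtype.ext hc) },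
    HahnSeries.ext rfl⟩

/-- The local degree is multiplicative. -/
theorem localDegree_mul {K : Type u} [Field K] [CharZero K] {f g : HahnSeries ℝ K} {x y : ℝ}
    (hf : f.support ⊆ Set.Iic x) (hg : g.support ⊆ Set.Iic y) :
    localDegree (f * g) (x + y) = localDegree f x ♯ᵇ localDegree g y := by
  -- Local degrees depend only on supports, which injective maps of coefficients preserve, so the
  -- computation can move to `S` and then to `ℂ`.
  obtain ⟨S, hS, _⟩ : ∃ S : Subfield K,
      Set.range f.coeff ∪ Set.range g.coeff ⊆ S ∧ Countable S := by
    refine ⟨Subfield.closure (Set.range f.coeff ∪ Set.range g.coeff), Subfield.subset_closure, ?_⟩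
    rw [← Cardinal.mk_le_aleph0_iff]
    refine (Subfield.cardinalMk_closure_le_max _).trans (max_le ?_ le_rfl)
    exact Cardinal.le_aleph0_iff_set_countable.2
      ((countable_range_coeff f).union (countable_range_coeff g))
  obtain ⟨φ⟩ := exists_ringHom_complex S
  obtain ⟨f, rfl⟩ := exists_map_subtype_eq S f (Set.subset_union_left.trans hS)
  obtain ⟨g, rfl⟩ := exists_map_subtype_eq S g (Set.subset_union_right.trans hS)
  have hinj : Function.Injective (Subfield.subtype S) := S.subtype.injective
  rw [support_map_of_injective hinj] at hf hg
  rw [← map_ringHom_mul]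
  simp only [localDegree_map_of_injective hinj]
  rw [← localDegree_map_of_injective φ.injective f, ← localDegree_map_of_injective φ.injective g,
    ← localDegree_map_of_injective φ.injective (f * g), map_ringHom_mul]
  refine localDegree_mul_of_complex ?_ ?_ <;> rwa [support_map_of_injective φ.injective]

/-! ### Degrees -/

theorem degree_add_le {K : Type u} [AddCommGroup K] {f g : HahnSeries ℝ K} {x : ℝ}
    (hf : f.support ⊆ Set.Iic x) (hg : g.support ⊆ Set.Iic x) :
    degree (f + g) ≤ max (degree f) (degree g) := by
  obtain ⟨u, hu⟩ := exists_localDegree_eq_degree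
    ((HahnSeries.support_add_subset f g).trans (Set.union_subset hf hg))
  rw [← hu]
  exact (localDegree_add_le f g u).trans
    (max_le_max (localDegree_le_degree f u) (localDegree_le_degree g u))

theorem degree_mul_le {K : Type u} [Ring K] {f g : HahnSeries ℝ K} {x y : ℝ}
    (hf : f.support ⊆ Set.Iic x) (hg : g.support ⊆ Set.Iic y) :
    degree (f * g) ≤ degree f ♯ᵇ degree g := by
  obtain ⟨u, hu⟩ := exists_localDegree_eq_degree (support_mul_subset_Iic hf hg)
  obtain ⟨d, hd⟩ := exists_localDegree_mul_le f g u
  rw [← hu]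
  exact hd.trans
    (naturalSumBot_le_naturalSumBot (localDegree_le_degree f d) (localDegree_le_degree g _))

/-- The first point at which the local degree is the degree. -/
theorem exists_isLeast_localDegree_eq {K : Type u} [Zero K] {f : HahnSeries ℝ K} {x : ℝ}
    (hf : f.support ⊆ Set.Iic x) (hd : degree f ≠ ⊥) :
    ∃ m, localDegree f m = degree f ∧ ∀ u < m, localDegree f u < degree f := by
  obtain ⟨m, hm, hmin⟩ := exists_isLeast_of_localDegree_ne_bot f
    (s := {u | localDegree f u = degree f}) (exists_localDegree_eq_degree hf)
    fun u hu => by rwa [hu]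
  exact ⟨m, hm, fun u hu => (localDegree_le_degree f u).lt_of_ne fun h => (hmin h).not_gt hu⟩

/-- Let `m`, `n` be the first points where `f`, `g` attain their degrees. The product of the parts
up to `m` and `n` has the full local degree at `m + n`. Any other pair with sum `m + n` has a point
before `m` or before `n`, where the local degree is smaller, so the remaining products cannot cancel
it. -/
theorem degree_mul {K : Type u} [Field K] [CharZero K] {f g : HahnSeries ℝ K} {x y : ℝ}
    (hf : f.support ⊆ Set.Iic x) (hg : g.support ⊆ Set.Iic y) :
    degree (f * g) = degree f ♯ᵇ degree g := by
  refine le_antisymm (degree_mul_le hf hg) ?_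
  by_cases hdf : degree f = ⊥
  · rw [hdf, bot_naturalSumBot]
    exact bot_le
  by_cases hdg : degree g = ⊥
  · rw [hdg, naturalSumBot_bot]
    exact bot_le
  obtain ⟨m, hm, hmlt⟩ := exists_isLeast_localDegree_eq hf hdf
  obtain ⟨n, hn, hnlt⟩ := exists_isLeast_localDegree_eq hg hdg
  set f₁ := restrict (Set.Iic m) f
  set f₂ := restrict (Set.Ioi m) f
  set g₁ := restrict (Set.Iic n) g
  set g₂ := restrict (Set.Ioi n) g
  have hff : f₁ + f₂ = f := restrict_Iic_add_restrict_Ioi f m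
  have hgg : g₁ + g₂ = g := restrict_Iic_add_restrict_Ioi g n
  have hmain : localDegree (f₁ * g₁) (m + n) = degree f ♯ᵇ degree g := by
    rw [localDegree_mul, localDegree_restrict_Iic_of_le f le_rfl,
      localDegree_restrict_Iic_of_le g le_rfl, hm, hn]
    · rw [support_restrict]
      exact Set.inter_subset_left
    · rw [support_restrict]
      exact Set.inter_subset_left
  have hbot : ⊥ < degree f ♯ᵇ degree g := by
    obtain ⟨b, hb⟩ := WithBot.ne_bot_iff_exists.1 hdf
    obtain ⟨c, hc⟩ := WithBot.ne_bot_iff_exists.1 hdg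
    rw [← hb, ← hc, coe_naturalSumBot_coe]
    exact WithBot.bot_lt_coe _
  have h1 : localDegree (f₁ * g₂) (m + n) < degree f ♯ᵇ degree g := by
    refine localDegree_mul_lt _ _ fun d => ?_
    rcases lt_or_ge d m with hd | hd
    · exact naturalSumBot_lt_naturalSumBot_of_lt_of_le
        ((localDegree_restrict_le _ _ _).trans_lt (hmlt d hd))
        ((localDegree_restrict_le _ _ _).trans (localDegree_le_degree g _)) hdg
    · rw [localDegree_restrict_Ioi_of_le g (by linarith : m + n - d ≤ n), naturalSumBot_bot]
      exact hbot
  have h2 : localDegree (f₂ * g) (m + n) < degree f ♯ᵇ degree g := by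
    refine localDegree_mul_lt _ _ fun d => ?_
    rcases le_or_gt d m with hd | hd
    · rw [localDegree_restrict_Ioi_of_le f hd, bot_naturalSumBot]
      exact hbot
    · exact naturalSumBot_lt_naturalSumBot_of_le_of_lt
        ((localDegree_restrict_le _ _ _).trans (localDegree_le_degree f _))
        (hnlt _ (by linarith)) hdf
  have hsplit : f * g = f₁ * g₁ + (f₁ * g₂ + f₂ * g) := by
    conv_lhs => rw [← hff, add_mul]
    rw [← add_assoc, ← mul_add, hgg]
  rw [← hmain] at h1 h2 ⊢
  calc localDegree (f₁ * g₁) (m + n) = localDegree (f * g) (m + n) := by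
        rw [hsplit, localDegree_add_of_lt]
        exact (localDegree_add_le _ _ _).trans_lt (max_lt h1 h2)
    _ ≤ degree (f * g) := localDegree_le_degree _ _

end GenSeries

end

theorem theoremD {K : Type*} [Field K] [CharZero K] :
    (∀ b : GenSeries.nonposSeries K,
      GenSeries.degree (b : HahnSeries ℝ K) = ⊥ ↔ b = 0) ∧
    (∀ b c : GenSeries.nonposSeries K,
      GenSeries.degree ((b + c : GenSeries.nonposSeries K) : HahnSeries ℝ K) ≤
        max (GenSeries.degree (b : HahnSeries ℝ K)) (GenSeries.degree (c : HahnSeries ℝ K))) ∧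
    (∀ b c : GenSeries.nonposSeries K,
      GenSeries.degree ((b * c : GenSeries.nonposSeries K) : HahnSeries ℝ K) =
        GenSeries.naturalSumBot (GenSeries.degree (b : HahnSeries ℝ K))
          (GenSeries.degree (c : HahnSeries ℝ K))) :=
  ⟨fun _ => ⟨fun h => Subtype.ext (GenSeries.degree_eq_bot_iff.1 h),
      fun h => GenSeries.degree_eq_bot_iff.2 (congrArg Subtype.val h)⟩,
    fun b c => GenSeries.degree_add_le b.2 c.2, fun b c => GenSeries.degree_mul b.2 c.2⟩
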